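/- Consider a general-sum stochastic game with agents $[n]$, a finite state space $\mathcal S$, finite action sets $\mathcal A_i$ with $|\mathcal A_i|\ge 2$, joint actions $\mathcal A=\prod_i\mathcal A_i$, horizon $H$, transition probabilities $P_h(s'\mid s,a)$ and stage rewards $r_{i,h}:\mathcal S\times\mathcal A\to[0,1]$. A policy is $\pi=(\pi_h:\mathcal S\to\Delta(\mathcal A))_{h=1}^H$, with value functions $V_{i,h}^\pi(s)=\mathbb E^\pi[\sum_{h'=h}^H r_{i,h'}(s_{h'},a_{h'})\mid s_h=s]$ and $Q_{i,h}^\pi(s,a)=\mathbb E^\pi[\sum_{h'=h}^H r_{i,h'}(s_{h'},a_{h'})\mid s_h=s,a_h=a]$. Assume that payoffs are normalized so that $Q_{i,h}^\pi(s,a)<1$ for all $\pi,i,h,s,a$, and that the game is interdependent: for every policy $\pi$, stage $h$, state $s$, joint action $a$ and every nonempty proper subset $J\subsetneq[n]$ there are an agent $i\notin J$ and actions $a_J'\in\prod_{j\in J}\mathcal A_j$ with $Q_{i,h}^\pi(s,(a_J',a_{-J}))\ne Q_{i,h}^\pi(s,a)$. Mood-based learning rule: let $c\ge n$ be a constant and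 $0<\epsilon<1$. For payoffs $u_i:\mathcal A\to[0,1)$, let $K^\epsilon(\cdot,\cdot\mid a,\xi;\{u_i\})$ be the following transition kernel on $\mathcal A\times\{\mathrm C,\mathrm D\}^n$. Independently for each agent $i$: if $\xi_i=\mathrm D$, then $a_i'$ is uniform on $\mathcal A_i$; if $\xi_i=\mathrm C$, then $a_i'=a_i$ with probability $1-\epsilon^c$, and with probability $\epsilon^c$ it is uniform on $\mathcal A_i\setminus\{a_i\}$. Then, given the new joint action $a'$, independently for each $i$: if $\xi_i=\mathrm C$ and $a'=a$, then $\xi_i'=\mathrm C$; otherwise $\xi_i'=\mathrm C$ with probability $\epsilon^{1-u_i(a')}$ and $\xi_i'=\mathrm D$ with the remaining probability. Algorithm: start from any (random) $a_h^{(0)}(s)\in\mathcal A$, $\xi_h^{(0)}(s)\in\{\mathrm C,\mathrm D\}^n$, with $V^{(0)}_{i,h}=0$, $V^{(t)}_{i,H+1}=0$ and $Q^{(0)}_{i,h}=r_{i,h}$. For $t=0,1,\dots$ draw, independently over all $h,s$ given the past, $(a_h^{(t+1)}(s),\xi_h^{(t+1)}(s))\sim K^\epsilon(\cdot,\cdot\mid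 a_h^{(t)}(s),\xi_h^{(t)}(s);\{Q_{i,h}^{(t)}(s,\cdot)\})$, and set $$V_{i,h}^{(t+1)}(s)=\tfrac{t}{t+1}V_{i,h}^{(t)}(s)+\tfrac1{t+1}Q_{i,h}^{(t)}(s,a_h^{(t)}(s)),\qquad Q_{i,h}^{(t+1)}(s,a)=r_{i,h}(s,a)+\sum_{s'}P_h(s'\mid s,a)V_{i,h+1}^{(t+1)}(s').$$ Let $\pi_h^{(t)}(\cdot,\cdot\mid s)$ be the distribution of $(a_h^{(t)}(s),\xi_h^{(t)}(s))$. Then for every $\epsilon\in(0,1)$ the limit $\pi^\epsilon_h(a,\xi\mid s)=\lim_{t\to\infty}\pi^{(t)}_h(a,\xi\mid s)$ exists and does not depend on the initialization; the limit $\pi^\star=\lim_{\epsilon\to0^+}\pi^\epsilon$ exists; and its action marginal $\pi^\star_h(a\mid s)=\sum_\xi\pi_h^\star(a,\xi\mid s)$ is a Pareto optimal policy, i.e. $\sum_{i=1}^n V_{i,h}^{\pi^\star}(s)\ge\sum_{i=1}^n V_{i,h}^{\pi}(s)$ for all policies $\pi$, all $h\in[H]$ and all $s\in\mathcal S$. 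-/

import Mathlib

open Filter Topology

/-- The mood of an agent. -/
inductive Mood where
  | content : Mood
  | discontent : Mood
  deriving DecidableEq

instance : Fintype Mood where
  elems := {Mood.content, Mood.discontent}
  complete := by intro m; cases m <;> simp

namespace NormalForm

variable {n : ℕ} {A : Fin n → Type*}

/-- A normal-form game `u` (`u i a` is the payoff of agent `i` at the joint action `a`) is
interdependent if, at every joint action, every nonempty proper set `J` of agents can change the
payoff of some agent outside `J` by changing only the actions of the members of `J`. -/
def Interdependent (u : Fin n → (∀ i, A i) → ℝ) : Prop :=
  ∀ a : (∀ i, A i), ∀ J : Finset (Fin n), J.Nonempty → J ≠ Finset.univ →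
    ∃ i, i ∉ J ∧ ∃ a' : (∀ i, A i), (∀ j, j ∉ J → a' j = a j) ∧ u i a' ≠ u i a

variable [∀ i, Fintype (A i)] [∀ i, DecidableEq (A i)]

/-- Probability that agent `i`, whose current action is `b` and whose mood is `m`, plays `b'`
next. -/
noncomputable def actionProb (c ε : ℝ) (i : Fin n) (m : Mood) (b b' : A i) : ℝ :=
  match m with
  | Mood.discontent => 1 / (Fintype.card (A i) : ℝ)
  | Mood.content =>
      if b' = b then 1 - ε ^ c else ε ^ c / ((Fintype.card (A i) : ℝ) - 1)

/-- Probability that agent `i`, whose mood is `m`, has mood `m'` next, when the joint action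
changes from `a` to `a'`. -/
noncomputable def moodProb (ε : ℝ) (u : Fin n → (∀ i, A i) → ℝ) (i : Fin n)
    (m : Mood) (a a' : ∀ i, A i) (m' : Mood) : ℝ :=
  if m = Mood.content ∧ a' = a then
    (if m' = Mood.content then 1 else 0)
  else
    match m' with
    | Mood.content => ε ^ (1 - u i a')
    | Mood.discontent => 1 - ε ^ (1 - u i a')

/-- Transition probability from `z` to `z'` (joint action, moods) of the mood-based learning rule
with experimentation exponent `c` and rate of mistakes `ε`, for the normal-form game `u`. -/
noncomputable def moodKernel (c ε : ℝ) (u : Fin n → (∀ i, A i) → ℝ)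
    (z z' : (∀ i, A i) × (Fin n → Mood)) : ℝ :=
  (∏ i, actionProb c ε i (z.2 i) (z.1 i) (z'.1 i)) *
    ∏ i, moodProb ε u i (z.2 i) z.1 z'.1 (z'.2 i)

end NormalForm

/-- A finite-horizon general-sum stochastic game with agents `Fin n`, states `S`, action sets
`A i`, and stages `0, …, H - 1`; data at stages `≥ H` play no role. -/
structure StochasticGame {n : ℕ} (H : ℕ) (S : Type*) [Fintype S] (A : Fin n → Type*) where
  /-- `P h s a s'` is the probability of moving from `s` at stage `h` to `s'` at stage `h + 1`
  under the joint action `a`. -/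
  P : ℕ → S → (∀ i, A i) → S → ℝ
  /-- `r i h s a` is the reward of agent `i` at stage `h`. -/
  r : Fin n → ℕ → S → (∀ i, A i) → ℝ
  P_mem : ∀ h, h < H → ∀ s a, P h s a ∈ stdSimplex ℝ S
  r_mem : ∀ i h, h < H → ∀ s a, r i h s a ∈ Set.Icc (0 : ℝ) 1

namespace StochasticGame

variable {n H : ℕ} {S : Type*} [Fintype S] [DecidableEq S] {A : Fin n → Type*}
  [∀ i, Fintype (A i)] [∀ i, DecidableEq (A i)]

/-- `π h s a` is the probability of the joint action `a` at stage `h` and state `s`. -/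
def IsPolicy (_G : StochasticGame H S A) (π : ℕ → S → (∀ i, A i) → ℝ) : Prop :=
  ∀ h, h < H → ∀ s, π h s ∈ stdSimplex ℝ (∀ i, A i)

/-- Probability of the trajectory `w = ((s_h, a_h), (s_{h+1}, a_{h+1}), …, (s_{h+k}, a_{h+k}))`
under the policy `π`, when `(s_h, a_h)` has the distribution `μ`. -/
noncomputable def trajProb (G : StochasticGame H S A) (π : ℕ → S → (∀ i, A i) → ℝ)
    (h : ℕ) (μ : S × (∀ i, A i) → ℝ) {k : ℕ} (w : Fin (k + 1) → S × (∀ i, A i)) : ℝ :=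
  μ (w 0) * ∏ j : Fin k,
    (G.P (h + j) (w j.castSucc).1 (w j.castSucc).2 (w j.succ).1 *
      π (h + j + 1) (w j.succ).1 (w j.succ).2)

/-- Expected total reward of agent `i` over the stages `h, …, H - 1` (for `h < H`), when
`(s_h, a_h)` has the distribution `μ` and the policy `π` is used afterwards. -/
noncomputable def expectedReturn (G : StochasticGame H S A) (π : ℕ → S → (∀ i, A i) → ℝ)
    (i : Fin n) (h : ℕ) (μ : S × (∀ i, A i) → ℝ) : ℝ :=
  ∑ w : Fin (H - 1 - h + 1) → S × (∀ i, A i),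
    G.trajProb π h μ w * ∑ j : Fin (H - 1 - h + 1), G.r i (h + j) (w j).1 (w j).2

/-- The value function `V_{i,h}^π(s)`, for `h < H`. -/
noncomputable def V (G : StochasticGame H S A) (π : ℕ → S → (∀ i, A i) → ℝ)
    (i : Fin n) (h : ℕ) (s : S) : ℝ :=
  G.expectedReturn π i h (fun x => if x.1 = s then π h s x.2 else 0)

/-- The function `Q_{i,h}^π(s, a)`, for `h < H`. -/
noncomputable def Q (G : StochasticGame H S A) (π : ℕ → S → (∀ i, A i) → ℝ)
    (i : Fin n) (h : ℕ) (s : S) (a : ∀ i, A i) : ℝ :=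
  G.expectedReturn π i h (fun x => if x = (s, a) then 1 else 0)

/-- For every policy, stage and state, the Q-functions form an interdependent normal-form game. -/
def Interdependent (G : StochasticGame H S A) : Prop :=
  ∀ π, G.IsPolicy π → ∀ h, h < H → ∀ s,
    NormalForm.Interdependent (fun i a => G.Q π i h s a)

/-- A policy that maximizes the sum of the values among all policies, at every stage and state. -/
def IsParetoOptimal (G : StochasticGame H S A) (π : ℕ → S → (∀ i, A i) → ℝ) : Prop :=
  G.IsPolicy π ∧ ∀ π', G.IsPolicy π' → ∀ h, h < H → ∀ s,
    ∑ i, G.V π' i h s ≤ ∑ i, G.V π i h s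

/-- The joint action and the moods that the algorithm holds at each stage and state in one
iteration. -/
abbrev Config (_G : StochasticGame H S A) : Type _ :=
  Fin H → S → (∀ i, A i) × (Fin n → Mood)

/-- The critic's Q-estimate computed from its value estimate `v`. -/
noncomputable def criticQ (G : StochasticGame H S A) (v : Fin n → ℕ → S → ℝ)
    (i : Fin n) (h : ℕ) (s : S) (a : ∀ i, A i) : ℝ :=
  G.r i h s a + ∑ s', G.P h s a s' * v i (h + 1) s'

/-- The critic's value estimate at iteration `t`, when the configurations are `x 0, x 1, …`; it
depends on `x 0, …, x (t - 1)` only, and it is `0` at the terminal stage `H`. -/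
noncomputable def criticV (G : StochasticGame H S A) (x : ℕ → G.Config) :
    ℕ → Fin n → ℕ → S → ℝ
  | 0 => fun _ _ _ => 0
  | t + 1 => fun i h s =>
      if hh : h < H then
        (t : ℝ) / (t + 1) * criticV G x t i h s +
          1 / ((t : ℝ) + 1) * G.criticQ (criticV G x t) i h s (x t ⟨h, hh⟩ s).1
      else 0

/-- Probability that the algorithm, run with the mood-based rule and started from the distribution
`ν`, goes through the configurations `x 0, …, x t`. Given the past, the learning rule is applied
independently at all stages and states, with the critic's current Q-estimates as payoffs. -/
noncomputable def pathProb (G : StochasticGame H S A) (c ε : ℝ) (ν : G.Config → ℝ)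
    (x : ℕ → G.Config) : ℕ → ℝ
  | 0 => ν (x 0)
  | t + 1 => pathProb G c ε ν x t *
      ∏ h : Fin H, ∏ s : S,
        NormalForm.moodKernel c ε (fun i a => G.criticQ (G.criticV x t) i h s a)
          (x t h s) (x (t + 1) h s)

/-- The probability that at iteration `t` of the algorithm the joint action and the moods at stage
`h` and state `s` are `z`: the sum of the probabilities of all `(x 0, …, x t)` ending that way. -/
noncomputable def iterDist (G : StochasticGame H S A) (c ε : ℝ) (ν : G.Config → ℝ)
    (t : ℕ) (h : Fin H) (s : S) (z : (∀ i, A i) × (Fin n → Mood)) : ℝ :=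
  ∑ y : Fin (t + 1) → G.Config,
    if y (Fin.last t) h s = z then
      G.pathProb c ε ν (fun τ => y ⟨min τ t, by omega⟩) t
    else 0

end StochasticGame

/-! Two limits are taken, one after the other, each by backward induction over the stages.

For fixed `ε`, suppose that the critic's values at stage `h + 1` converge in mean. Then the
transition law at stage `h` approaches that of the mood rule with frozen payoffs, a chain that is
positive after two steps and therefore forgets its initial state. Hence the distribution at stage
`h` converges to the stationary one, and time averages converge in mean to stationary averages
(`tendsto_pathExp`, `tendsto_pathExp_average`). The critic's value is exactly a time average of
payoffs, so it converges at stage `h` as well (`tendsto_criticError`). Payoffs stay below `1`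
throughout, because no estimate exceeds the best value an agent can get
(`stageGame_optimalValue_lt_one`).

For `ε → 0⁺`, the stationary distribution is computed from its balance equations. While a joint
action `b` is repeated, content agents stay content, so the equations at `b` are triangular in the
set of content agents. They give each mood profile the weight: inflow into `b`, times `ε` to the sum
of `1 - u i b` over the content agents, times a factor whose limit does not depend on `b`; if all
agents are content, this is divided by the escape probability, about `n * ε ^ c`
(`stationary_asymptotics`). Joint actions are mostly left when all agents are discontent, and then
the new one is uniform, so all inflows are asymptotically equal (`inflow_asymptotics`). Relative to
the total inflow, an all-content state at `b` has weight of order `ε ^ (n - c - ∑ i, u i b)`, and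
the other moods are bounded. Since `c ≥ n`, only joint actions of maximal welfare survive
(`exists_stationary_limit`).

The payoffs themselves depend on `ε` through the continuation values, and they stand in exponents of
`ε`. Replacing them by their limits requires the error times `log ε` to vanish, so mere convergence
would not pass from one stage to the preceding one. A polynomial rate does: this is the purpose of
`PolyTendsto` and `PolyTendsto.rpow_sub`. Finally, the limit policy maximizes at every stage the
total payoff given its own continuation values, and the Bellman equations turn this into optimality.
-/

set_option linter.unusedSectionVars false

/-! ### Finite Markov chains -/

namespace FiniteChain

variable {Z : Type*} [Fintype Z]

/-- `p` is a stationary distribution of the transition matrix `K`. -/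
def IsStationary (K : Z → Z → ℝ) (p : Z → ℝ) : Prop :=
  p ∈ stdSimplex ℝ Z ∧ ∀ z', ∑ z, p z * K z z' = p z'

/-- The expectation of `f` after one step of the chain. -/
def step (K : Z → Z → ℝ) (f : Z → ℝ) (z : Z) : ℝ := ∑ z', K z z' * f z'

/-- Since `K - 1` kills the constants, it also has a left null vector `v`. The triangle inequality
makes `|v|` subinvariant, and both sides have the same total mass, so `|v|` is invariant and can be
normalized. -/
theorem exists_isStationary [Nonempty Z] {K : Z → Z → ℝ} (hK : ∀ z, K z ∈ stdSimplex ℝ Z) :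
    ∃ p, IsStationary K p := by
  classical
  let M : Matrix Z Z ℝ := Matrix.of K - 1
  have hM : M.det = 0 := by
    refine Matrix.exists_mulVec_eq_zero_iff.1 ⟨fun _ => 1, ?_, ?_⟩
    · intro h
      exact one_ne_zero (congrFun h (Classical.arbitrary Z))
    · ext z
      have h1 : M.mulVec (fun _ => 1) z = ∑ z', K z z' - 1 := by
        change ((Matrix.of K - 1).mulVec (1 : Z → ℝ)) z = _
        rw [Matrix.sub_mulVec, Matrix.one_mulVec]
        simp [Matrix.mulVec, dotProduct]
      rw [h1, (hK z).2, sub_self, Pi.zero_apply]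
  obtain ⟨v, hv0, hv⟩ := Matrix.exists_vecMul_eq_zero_iff.2 hM
  have hvK : ∀ z', ∑ z, v z * K z z' = v z' := by
    intro z'
    have := congrFun hv z'
    simp only [M, Matrix.vecMul_sub, Matrix.vecMul_one, Pi.sub_apply, Pi.zero_apply,
      sub_eq_zero] at this
    simpa [Matrix.vecMul, dotProduct] using this
  have hle : ∀ z', |v z'| ≤ ∑ z, |v z| * K z z' := by
    intro z'
    calc |v z'| = |∑ z, v z * K z z'| := by rw [hvK]
      _ ≤ ∑ z, |v z * K z z'| := Finset.abs_sum_le_sum_abs _ _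
      _ = ∑ z, |v z| * K z z' := by
          refine Finset.sum_congr rfl fun z _ => ?_
          rw [abs_mul, abs_of_nonneg ((hK z).1 z')]
  have hsum : ∑ z', |v z'| = ∑ z', ∑ z, |v z| * K z z' := by
    rw [Finset.sum_comm]
    refine Finset.sum_congr rfl fun z _ => ?_
    rw [← Finset.mul_sum, (hK z).2, mul_one]
  have heq : ∀ z', |v z'| = ∑ z, |v z| * K z z' := fun z' =>
    (Finset.sum_eq_sum_iff_of_le fun z' _ => hle z').1 hsum z' (Finset.mem_univ _)
  have hpos : 0 < ∑ z, |v z| := by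
    obtain ⟨z, hz⟩ := Function.ne_iff.1 hv0
    exact Finset.sum_pos' (fun _ _ => abs_nonneg _) ⟨z, Finset.mem_univ _, abs_pos.2 hz⟩
  refine ⟨fun z => |v z| / ∑ z, |v z|, ⟨fun z => by positivity, ?_⟩, fun z' => ?_⟩
  · rw [← Finset.sum_div, div_self hpos.ne']
  · change ∑ z, |v z| / (∑ z, |v z|) * K z z' = |v z'| / ∑ z, |v z|
    rw [heq z', Finset.sum_div]
    exact Finset.sum_congr rfl fun z _ => by ring

theorem IsStationary.sum_step {K : Z → Z → ℝ} {p : Z → ℝ} (hp : IsStationary K p) (f : Z → ℝ) :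
    ∑ z, p z * step K f z = ∑ z, p z * f z := by
  simp only [step, Finset.mul_sum]
  rw [Finset.sum_comm]
  refine Finset.sum_congr rfl fun z' _ => ?_
  rw [← hp.2 z', Finset.sum_mul]
  exact Finset.sum_congr rfl fun z _ => by ring

theorem step_step (K : Z → Z → ℝ) (f : Z → ℝ) (z : Z) :
    step K (step K f) z = ∑ z', (∑ w, K z w * K w z') * f z' := by
  simp only [step, Finset.mul_sum, Finset.sum_mul]
  rw [Finset.sum_comm]
  exact Finset.sum_congr rfl fun _ _ => Finset.sum_congr rfl fun _ _ => by ring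

theorem step_sub_const {K : Z → Z → ℝ} (hK : ∀ z, K z ∈ stdSimplex ℝ Z) (f : Z → ℝ) (b : ℝ) :
    step K (fun z => f z - b) = fun z => step K f z - b := by
  ext z
  simp only [step, mul_sub, Finset.sum_sub_distrib, ← Finset.sum_mul, (hK z).2, one_mul]

theorem IsStationary.pos {K : Z → Z → ℝ} {p : Z → ℝ} (hp : IsStationary K p)
    (hK2 : ∀ z z', 0 < ∑ w, K z w * K w z') (z : Z) : 0 < p z := by
  classical
  have h : ∑ w, p w * ∑ x, K w x * K x z = p z := by
    have h1 := hp.sum_step (step K (fun x => if x = z then 1 else 0))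
    rw [hp.sum_step (fun x => if x = z then 1 else 0)] at h1
    simpa [step_step] using h1
  rw [← h]
  have hs : 0 < ∑ w, p w := by rw [hp.1.2]; exact one_pos
  obtain ⟨w, -, hw⟩ := Finset.exists_lt_of_sum_lt (s := Finset.univ) (f := fun _ : Z => (0 : ℝ))
    (g := p) (by simpa using hs)
  exact Finset.sum_pos' (fun w _ => mul_nonneg (hp.1.1 w) (hK2 w z).le)
    ⟨w, Finset.mem_univ _, mul_pos hw (hK2 w z)⟩

/-- A chain with positive two-step transition probabilities forgets its initial state. -/
theorem IsStationary.exists_abs_iterate_step_sub_le {K : Z → Z → ℝ} {p : Z → ℝ}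
    (hp : IsStationary K p) (hK : ∀ z, K z ∈ stdSimplex ℝ Z)
    (hK2 : ∀ z z', 0 < ∑ w, K z w * K w z') (f : Z → ℝ) {δ : ℝ} (hδ : 0 < δ) :
    ∃ m : ℕ, ∀ z, |(step K)^[m] f z - ∑ z, p z * f z| ≤ δ := by
  classical
  obtain ⟨α, hα0, hα⟩ : ∃ α > 0, ∀ z z', α ≤ ∑ w, K z w * K w z' := by
    rcases isEmpty_or_nonempty Z with h | h
    · exact ⟨1, one_pos, fun z => (IsEmpty.false z).elim⟩
    · obtain ⟨x, hx⟩ := Finite.exists_min (fun x : Z × Z => ∑ w, K x.1 w * K w x.2)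
      exact ⟨_, hK2 x.1 x.2, fun z z' => hx (z, z')⟩
  rcases isEmpty_or_nonempty Z with h | h
  · exact ⟨0, fun z => (IsEmpty.false z).elim⟩
  have hK2sum : ∀ z, ∑ z', ∑ w, K z w * K w z' = 1 := by
    intro z
    rw [Finset.sum_comm]
    simp only [← Finset.mul_sum, (hK _).2, mul_one]
  have hp1 : ∀ z, p z ≤ 1 := fun z => by
    rw [← hp.1.2]
    exact Finset.single_le_sum (fun w _ => hp.1.1 w) (Finset.mem_univ z)
  have hα1 : α ≤ 1 := by
    obtain ⟨z⟩ := h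
    rw [← hK2sum z]
    exact (hα z z).trans (Finset.single_le_sum (f := fun z' => ∑ w, K z w * K w z')
      (fun w _ => (hK2 z w).le) (Finset.mem_univ z))
  -- Doeblin's argument: subtracting `α * p` from the two-step kernel changes nothing on functions
  -- of mean zero and leaves nonnegative weights of total mass `1 - α`.
  have contr : ∀ (g : Z → ℝ) (M : ℝ), ∑ z, p z * g z = 0 → (∀ z, |g z| ≤ M) →
      ∀ z, |step K (step K g) z| ≤ (1 - α) * M := by
    intro g M hg hM z
    have h1 : step K (step K g) z = ∑ z', ((∑ w, K z w * K w z') - α * p z') * g z' := by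
      rw [step_step]
      simp only [sub_mul, Finset.sum_sub_distrib, mul_assoc, ← Finset.mul_sum, hg]
      simp
    have h2 : ∀ z', 0 ≤ (∑ w, K z w * K w z') - α * p z' := fun z' => by
      have := hα z z'
      nlinarith [hp1 z', hp.1.1 z']
    rw [h1]
    calc _ ≤ ∑ z', |((∑ w, K z w * K w z') - α * p z') * g z'| :=
          Finset.abs_sum_le_sum_abs _ _
      _ ≤ ∑ z', ((∑ w, K z w * K w z') - α * p z') * M := by
          refine Finset.sum_le_sum fun z' _ => ?_
          rw [abs_mul, abs_of_nonneg (h2 z')]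
          exact mul_le_mul_of_nonneg_left (hM z') (h2 z')
      _ = (1 - α) * M := by
          rw [← Finset.sum_mul, Finset.sum_sub_distrib, hK2sum, ← Finset.mul_sum, hp.1.2, mul_one]
  set b := ∑ z, p z * f z with hb
  obtain ⟨M, hM⟩ : ∃ M, ∀ z, |f z - b| ≤ M := by
    obtain ⟨x, hx⟩ := Finite.exists_max (fun z => |f z - b|)
    exact ⟨_, hx⟩
  have key : ∀ m : ℕ, ∑ z, p z * ((step K)^[2 * m] f z - b) = 0 ∧
      ∀ z, |(step K)^[2 * m] f z - b| ≤ (1 - α) ^ m * M := by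
    intro m
    induction m with
    | zero =>
      refine ⟨?_, by simpa using hM⟩
      simp [mul_sub, Finset.sum_sub_distrib, ← Finset.sum_mul, hp.1.2, hb]
    | succ m ih =>
      have h3 : (fun z => (step K)^[2 * (m + 1)] f z - b) =
          step K (step K (fun z => (step K)^[2 * m] f z - b)) := by
        rw [step_sub_const hK, step_sub_const hK, show 2 * (m + 1) = (2 * m + 1) + 1 by ring,
          Function.iterate_succ_apply', Function.iterate_succ_apply']
      refine ⟨?_, fun z => ?_⟩
      · have h4 := ih.1
        rw [← hp.sum_step (fun z => (step K)^[2 * m] f z - b), ← hp.sum_step, ← h3] at h4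
        exact h4
      · rw [pow_succ', mul_assoc]
        have := contr _ _ ih.1 ih.2 z
        rwa [← h3] at this
  have hlim : Tendsto (fun m : ℕ => (1 - α) ^ m * M) atTop (𝓝 0) := by
    simpa using (tendsto_pow_atTop_nhds_zero_of_lt_one (by linarith) (by linarith)).mul_const M
  obtain ⟨m, hm⟩ := (hlim.eventually (ge_mem_nhds hδ)).exists
  exact ⟨2 * m, fun z => ((key m).2 z).trans hm⟩

/-- If `e t f` measures the deviation of a process from the stationary mean of `f`, and replacing
`f` by `step K f` changes it little, then it tends to zero. -/
theorem IsStationary.tendsto_error {K : Z → Z → ℝ} {p : Z → ℝ}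
    (hp : IsStationary K p) (hK : ∀ z, K z ∈ stdSimplex ℝ Z)
    (hK2 : ∀ z z', 0 < ∑ w, K z w * K w z') (e : ℕ → (Z → ℝ) → ℝ) (s : ℕ)
    (he0 : ∀ t f, 0 ≤ e t f)
    (hbd : ∀ t f δ, (∀ z, |f z - ∑ z, p z * f z| ≤ δ) → e t f ≤ δ)
    (hstep : ∀ f, ∃ η : ℕ → ℝ, Tendsto η atTop (𝓝 0) ∧
      ∀ t, e (t + s) f ≤ e t (step K f) + η t) (f : Z → ℝ) :
    Tendsto (fun t => e t f) atTop (𝓝 0) := by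
  have hiter : ∀ m : ℕ, ∀ f, ∃ η : ℕ → ℝ, Tendsto η atTop (𝓝 0) ∧
      ∀ t, e (t + s * m) f ≤ e t ((step K)^[m] f) + η t := by
    intro m
    induction m with
    | zero => exact fun f => ⟨fun _ => 0, tendsto_const_nhds, fun t => by simp⟩
    | succ m ih =>
      intro f
      obtain ⟨η, hη, h1⟩ := hstep f
      obtain ⟨η', hη', h2⟩ := ih (step K f)
      refine ⟨fun t => η' t + η (t + s * m), ?_, fun t => ?_⟩
      · simpa using hη'.add (hη.comp (tendsto_add_atTop_nat (s * m)))
      · have := h1 (t + s * m)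
        have h3 := h2 t
        rw [Function.iterate_succ_apply, show t + s * (m + 1) = t + s * m + s by ring]
        linarith
  have hmean : ∀ m : ℕ, ∑ z, p z * (step K)^[m] f z = ∑ z, p z * f z := by
    intro m
    induction m with
    | zero => rfl
    | succ m ih => rw [← ih, Function.iterate_succ_apply', hp.sum_step]
  rw [Metric.tendsto_atTop]
  intro δ hδ
  -- The number `m` of smoothing steps depends on `δ` only, so the sum of the `m` errors still
  -- vanishes as `t` grows.
  obtain ⟨m, hm⟩ := hp.exists_abs_iterate_step_sub_le hK hK2 f (half_pos hδ)
  obtain ⟨η, hη, h1⟩ := hiter m f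
  obtain ⟨N, hN⟩ := eventually_atTop.1 (hη.eventually (gt_mem_nhds (half_pos hδ)))
  refine ⟨N + s * m, fun t ht => ?_⟩
  obtain ⟨k, rfl⟩ : ∃ k, t = k + s * m := ⟨t - s * m, by omega⟩
  rw [Real.dist_eq, sub_zero, abs_of_nonneg (he0 _ _)]
  have h2 := hbd k ((step K)^[m] f) (δ / 2) (by rw [hmean]; exact hm)
  have h3 := hN k (by omega)
  have h4 := h1 k
  linarith

end FiniteChain

/-! ### Convergence with a polynomial rate -/

/-- `f ε` tends to `l` as `ε → 0⁺`, with an error of the order of a positive power of `ε`. -/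
def PolyTendsto (f : ℝ → ℝ) (l : ℝ) : Prop :=
  ∃ δ > (0 : ℝ), (fun ε => f ε - l) =O[𝓝[>] 0] fun ε => ε ^ δ

namespace PolyTendsto

variable {f g : ℝ → ℝ} {l m : ℝ}

theorem rpow_isBigO {δ δ' : ℝ} (h : δ ≤ δ') :
    (fun ε : ℝ => ε ^ δ') =O[𝓝[>] 0] fun ε => ε ^ δ := by
  refine Asymptotics.IsBigO.of_bound 1 ?_
  filter_upwards [Ioo_mem_nhdsGT (zero_lt_one' ℝ)] with ε hε
  rw [Real.norm_of_nonneg (Real.rpow_nonneg hε.1.le _),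
    Real.norm_of_nonneg (Real.rpow_nonneg hε.1.le _), one_mul]
  exact Real.rpow_le_rpow_of_exponent_ge hε.1 hε.2.le h

theorem tendsto_rpow_zero {δ : ℝ} (hδ : 0 < δ) :
    Tendsto (fun ε : ℝ => ε ^ δ) (𝓝[>] 0) (𝓝 0) := by
  have h := (Real.continuousAt_rpow_const 0 δ (Or.inr hδ.le)).tendsto
  rw [Real.zero_rpow hδ.ne'] at h
  exact h.mono_left nhdsWithin_le_nhds

theorem tendsto (h : PolyTendsto f l) : Tendsto f (𝓝[>] 0) (𝓝 l) := by
  obtain ⟨δ, hδ, h⟩ := h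
  have := (h.trans_tendsto (tendsto_rpow_zero hδ)).add_const l
  simpa using this

theorem of_isBigO_sub {r : ℝ → ℝ} (hr : PolyTendsto r 0)
    (h : (fun ε => f ε - l) =O[𝓝[>] 0] r) : PolyTendsto f l := by
  obtain ⟨δ, hδ, hr⟩ := hr
  exact ⟨δ, hδ, h.trans (by simpa using hr)⟩

theorem isBigO_one (h : PolyTendsto f l) : f =O[𝓝[>] 0] fun _ => (1 : ℝ) :=
  h.tendsto.isBigO_one ℝ

theorem sub_const (h : PolyTendsto f l) : PolyTendsto (fun ε => f ε - l) 0 := by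
  obtain ⟨δ, hδ, h⟩ := h
  exact ⟨δ, hδ, by simpa using h⟩

theorem const (l : ℝ) : PolyTendsto (fun _ => l) l :=
  ⟨1, one_pos, by simpa using Asymptotics.isBigO_zero _ _⟩

theorem congr' (h : PolyTendsto f l) (hfg : ∀ᶠ ε in 𝓝[>] 0, f ε = g ε) : PolyTendsto g l := by
  obtain ⟨δ, hδ, h⟩ := h
  refine ⟨δ, hδ, h.congr' ?_ EventuallyEq.rfl⟩
  filter_upwards [hfg] with ε hε
  rw [hε]

theorem add (hf : PolyTendsto f l) (hg : PolyTendsto g m) :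
    PolyTendsto (fun ε => f ε + g ε) (l + m) := by
  obtain ⟨δ, hδ, hf⟩ := hf
  obtain ⟨δ', hδ', hg⟩ := hg
  refine ⟨min δ δ', lt_min hδ hδ', ?_⟩
  refine ((hf.trans (rpow_isBigO (min_le_left δ δ'))).add
    (hg.trans (rpow_isBigO (min_le_right δ δ')))).congr_left fun ε => ?_
  ring

/-- For factors that are bounded but not yet known to converge, such as the shares of the inflow. -/
theorem zero_mul_bounded (hf : PolyTendsto f 0) (hg : g =O[𝓝[>] 0] fun _ => (1 : ℝ)) :
    PolyTendsto (fun ε => f ε * g ε) 0 := by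
  refine hf.of_isBigO_sub ?_
  simpa using (Asymptotics.isBigO_refl f (𝓝[>] 0)).mul hg

theorem mul (hf : PolyTendsto f l) (hg : PolyTendsto g m) :
    PolyTendsto (fun ε => f ε * g ε) (l * m) := by
  have h1 := hf.sub_const.zero_mul_bounded hg.isBigO_one
  have h2 := hg.sub_const.zero_mul_bounded (const l).isBigO_one
  have := (h1.add h2).add (const (l * m))
  simp only [zero_add] at this
  refine this.congr' (Eventually.of_forall fun ε => ?_)
  ring

theorem const_mul (hf : PolyTendsto f l) (b : ℝ) : PolyTendsto (fun ε => b * f ε) (b * l) :=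
  (const b).mul hf

theorem sub (hf : PolyTendsto f l) (hg : PolyTendsto g m) :
    PolyTendsto (fun ε => f ε - g ε) (l - m) := by
  have := hf.add (hg.const_mul (-1))
  simpa [sub_eq_add_neg] using this

theorem inv (hf : PolyTendsto f l) (hl : l ≠ 0) : PolyTendsto (fun ε => (f ε)⁻¹) l⁻¹ := by
  have h1 : (fun ε => (f ε)⁻¹) =O[𝓝[>] 0] fun _ => (1 : ℝ) :=
    (hf.tendsto.inv₀ hl).isBigO_one ℝ
  have h2 := (hf.sub_const.zero_mul_bounded h1).const_mul (-l⁻¹)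
  have h3 := h2.add (const l⁻¹)
  rw [mul_zero, zero_add] at h3
  refine h3.congr' ?_
  filter_upwards [hf.tendsto.eventually_ne hl] with ε hε
  field_simp
  ring

theorem div (hf : PolyTendsto f l) (hg : PolyTendsto g m) (hm : m ≠ 0) :
    PolyTendsto (fun ε => f ε / g ε) (l / m) := by
  simpa [div_eq_mul_inv] using hf.mul (hg.inv hm)

theorem sum {ι : Type*} (s : Finset ι) {F : ι → ℝ → ℝ} {L : ι → ℝ}
    (h : ∀ i ∈ s, PolyTendsto (F i) (L i)) :
    PolyTendsto (fun ε => ∑ i ∈ s, F i ε) (∑ i ∈ s, L i) := by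
  classical
  induction s using Finset.induction_on with
  | empty => simpa using const 0
  | insert i s hi ih =>
    simp only [Finset.sum_insert hi]
    exact (h i (by simp)).add (ih fun j hj => h j (by simp [hj]))

theorem prod {ι : Type*} (s : Finset ι) {F : ι → ℝ → ℝ} {L : ι → ℝ}
    (h : ∀ i ∈ s, PolyTendsto (F i) (L i)) :
    PolyTendsto (fun ε => ∏ i ∈ s, F i ε) (∏ i ∈ s, L i) := by
  classical
  induction s using Finset.induction_on with
  | empty => simpa using const 1
  | insert i s hi ih =>
    simp only [Finset.prod_insert hi]
    exact (h i (by simp)).mul (ih fun j hj => h j (by simp [hj]))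

theorem rpow_pos {r : ℝ} (hr : 0 < r) : PolyTendsto (fun ε => ε ^ r) 0 :=
  ⟨r, hr, by simpa using Asymptotics.isBigO_refl _ _⟩

theorem rpow {r : ℝ} (hr : 0 ≤ r) : PolyTendsto (fun ε => ε ^ r) (if r = 0 then 1 else 0) := by
  split_ifs with h
  · simpa [h] using const 1
  · exact rpow_pos (lt_of_le_of_ne hr (Ne.symm h))

/-- An exponent that converges at a polynomial rate may be replaced by its limit. -/
theorem rpow_sub (hf : PolyTendsto f l) : PolyTendsto (fun ε => ε ^ (l - f ε)) 1 := by
  obtain ⟨δ, hδ, h⟩ := hf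
  -- Half of the rate `δ` is spent on absorbing the logarithm; the other half remains as the rate of
  -- the exponent.
  have h1 : Real.log =O[𝓝[>] 0] fun ε => ε ^ (-(δ / 2)) :=
    (isLittleO_log_rpow_nhdsGT_zero (by linarith)).isBigO
  have h2 : (fun ε => Real.log ε * (l - f ε)) =O[𝓝[>] 0] fun ε => ε ^ (δ / 2) := by
    have h3 : (fun ε => l - f ε) =O[𝓝[>] 0] fun ε => ε ^ δ := by
      refine h.neg_left.congr_left fun ε => ?_
      ring
    refine (h1.mul h3).congr' EventuallyEq.rfl ?_
    filter_upwards [self_mem_nhdsWithin] with ε (hε : 0 < ε)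
    rw [← Real.rpow_add hε]
    congr 1
    ring
  have h3 : PolyTendsto (fun ε => Real.log ε * (l - f ε)) 0 :=
    ⟨δ / 2, by linarith, by simpa using h2⟩
  refine h3.of_isBigO_sub ?_
  have h4 : (fun x : ℝ => Real.exp x - 1) =O[𝓝 0] fun x => x := by
    simpa using (Real.hasDerivAt_exp 0).isBigO_sub
  refine (h4.comp_tendsto h3.tendsto).congr' ?_ EventuallyEq.rfl
  filter_upwards [self_mem_nhdsWithin] with ε (hε : 0 < ε)
  simp [Real.rpow_def_of_pos hε]

end PolyTendsto

/-! ### The mood-based learning rule -/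

theorem pi_prod_mem_stdSimplex {ι : Type*} [Fintype ι] [DecidableEq ι] {B : ι → Type*}
    [∀ i, Fintype (B i)]
    {p : ∀ i, B i → ℝ} (hp : ∀ i, p i ∈ stdSimplex ℝ (B i)) :
    (fun b : ∀ i, B i => ∏ i, p i (b i)) ∈ stdSimplex ℝ (∀ i, B i) := by
  refine ⟨fun b => Finset.prod_nonneg fun i _ => (hp i).1 _, ?_⟩
  have := Finset.prod_univ_sum (fun i => (Finset.univ : Finset (B i))) p
  rw [Fintype.piFinset_univ] at this
  rw [← this]
  exact Finset.prod_eq_one fun i _ => (hp i).2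

theorem abs_prod_sub_prod_le {ι : Type*} (s : Finset ι) {f g : ι → ℝ}
    (hf : ∀ i ∈ s, |f i| ≤ 1) (hg : ∀ i ∈ s, |g i| ≤ 1) :
    |∏ i ∈ s, f i - ∏ i ∈ s, g i| ≤ ∑ i ∈ s, |f i - g i| := by
  classical
  induction s using Finset.induction_on with
  | empty => simp
  | insert i s hi ih =>
    rw [Finset.prod_insert hi, Finset.prod_insert hi, Finset.sum_insert hi]
    have h1 := ih (fun j hj => hf j (by simp [hj])) fun j hj => hg j (by simp [hj])
    have h2 : |∏ j ∈ s, f j| ≤ 1 := by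
      rw [Finset.abs_prod]
      exact Finset.prod_le_one (fun _ _ => abs_nonneg _) fun j hj => hf j (by simp [hj])
    have h3 := hg i (by simp)
    calc |f i * ∏ j ∈ s, f j - g i * ∏ j ∈ s, g j|
        = |(f i - g i) * ∏ j ∈ s, f j + g i * (∏ j ∈ s, f j - ∏ j ∈ s, g j)| := by ring_nf
      _ ≤ |f i - g i| * |∏ j ∈ s, f j| + |g i| * |∏ j ∈ s, f j - ∏ j ∈ s, g j| := by
          rw [← abs_mul, ← abs_mul]
          exact abs_add_le _ _
      _ ≤ |f i - g i| * 1 + 1 * |∏ j ∈ s, f j - ∏ j ∈ s, g j| := by gcongr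
      _ ≤ _ := by linarith

namespace Mood

theorem eq_discontent_of_ne {m : Mood} (h : m ≠ content) : m = discontent := by
  cases m
  · exact absurd rfl h
  · rfl

theorem sum_univ (f : Mood → ℝ) : ∑ m, f m = f content + f discontent :=
  Finset.sum_pair (by simp)

end Mood

namespace NormalForm

variable {n : ℕ} {A : Fin n → Type*} [∀ i, Fintype (A i)] [∀ i, DecidableEq (A i)]

theorem one_lt_card [∀ i, Nontrivial (A i)] (i : Fin n) : (1 : ℝ) < Fintype.card (A i) := by
  exact_mod_cast Fintype.one_lt_card

theorem actionProb_mem_stdSimplex [∀ i, Nontrivial (A i)] {c ε : ℝ} (hc : 0 ≤ c)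
    (hε : ε ∈ Set.Ioo (0 : ℝ) 1) (i : Fin n) (m : Mood) (b : A i) :
    actionProb c ε i m b ∈ stdSimplex ℝ (A i) := by
  have h1 := one_lt_card (A := A) i
  have h2 : 0 ≤ ε ^ c := Real.rpow_nonneg hε.1.le c
  have h3 : ε ^ c ≤ 1 := Real.rpow_le_one hε.1.le hε.2.le hc
  cases m with
  | discontent =>
    refine ⟨fun b' => by simp only [actionProb]; positivity, ?_⟩
    simp only [actionProb, Finset.sum_const, Finset.card_univ, nsmul_eq_mul]
    field_simp
  | content =>
    refine ⟨fun b' => ?_, ?_⟩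
    · simp only [actionProb]
      split_ifs
      · linarith
      · exact div_nonneg h2 (by linarith)
    · simp only [actionProb]
      rw [← Finset.add_sum_erase _ _ (Finset.mem_univ b), if_pos rfl,
        Finset.sum_congr rfl (fun b' hb' => if_neg (Finset.ne_of_mem_erase hb')),
        Finset.sum_const, Finset.card_erase_of_mem (Finset.mem_univ b), Finset.card_univ,
        nsmul_eq_mul, Nat.cast_sub Fintype.card_pos, Nat.cast_one]
      have : (Fintype.card (A i) : ℝ) - 1 ≠ 0 := by linarith
      field_simp
      ring

theorem actionProb_pos [∀ i, Nontrivial (A i)] {c ε : ℝ} (hc : 0 < c)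
    (hε : ε ∈ Set.Ioo (0 : ℝ) 1) (i : Fin n) (m : Mood) (b b' : A i) :
    0 < actionProb c ε i m b b' := by
  have h1 := one_lt_card (A := A) i
  have h2 : 0 < ε ^ c := Real.rpow_pos_of_pos hε.1 c
  have h3 : ε ^ c < 1 := Real.rpow_lt_one hε.1.le hε.2 hc
  cases m with
  | discontent => simp only [actionProb]; positivity
  | content =>
    simp only [actionProb]
    split_ifs
    · linarith
    · exact div_pos h2 (by linarith)

theorem moodProb_of_not {ε : ℝ} {u : Fin n → (∀ i, A i) → ℝ} {i : Fin n} {m : Mood}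
    {a a' : ∀ i, A i} (h : ¬ (m = Mood.content ∧ a' = a)) (m' : Mood) :
    moodProb ε u i m a a' m' = moodProb ε u i Mood.discontent a' a' m' := by
  simp [moodProb, h]

theorem moodProb_mem_stdSimplex {ε : ℝ} {u : Fin n → (∀ i, A i) → ℝ}
    (hε : ε ∈ Set.Ioo (0 : ℝ) 1) (hu : ∀ i a, u i a ≤ 1) (i : Fin n) (m : Mood)
    (a a' : ∀ i, A i) : moodProb ε u i m a a' ∈ stdSimplex ℝ Mood := by
  have h1 : 0 ≤ ε ^ (1 - u i a') := Real.rpow_nonneg hε.1.le _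
  have h2 : ε ^ (1 - u i a') ≤ 1 :=
    Real.rpow_le_one hε.1.le hε.2.le (by linarith [hu i a'])
  by_cases h : m = Mood.content ∧ a' = a
  · refine ⟨fun m' => ?_, ?_⟩
    · simp only [moodProb, if_pos h]
      split_ifs <;> norm_num
    · simp [moodProb, h]
  · refine ⟨fun m' => ?_, ?_⟩
    · cases m' <;> simp only [moodProb, if_neg h] <;> linarith
    · simp [Mood.sum_univ, moodProb, h]

theorem moodProb_pos {ε : ℝ} {u : Fin n → (∀ i, A i) → ℝ}
    (hε : ε ∈ Set.Ioo (0 : ℝ) 1) (hu : ∀ i a, u i a < 1) {i : Fin n} {m : Mood}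
    {a a' : ∀ i, A i} (h : ¬ (m = Mood.content ∧ a' = a)) (m' : Mood) :
    0 < moodProb ε u i m a a' m' := by
  have h1 : 0 < ε ^ (1 - u i a') := Real.rpow_pos_of_pos hε.1 _
  have h2 : ε ^ (1 - u i a') < 1 := Real.rpow_lt_one hε.1.le hε.2 (by linarith [hu i a'])
  cases m' <;> simp only [moodProb, if_neg h] <;> linarith

theorem moodKernel_mem_stdSimplex [∀ i, Nontrivial (A i)] {c ε : ℝ} (hc : 0 ≤ c)
    (hε : ε ∈ Set.Ioo (0 : ℝ) 1) {u : Fin n → (∀ i, A i) → ℝ} (hu : ∀ i a, u i a ≤ 1)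
    (z : (∀ i, A i) × (Fin n → Mood)) :
    moodKernel c ε u z ∈ stdSimplex ℝ ((∀ i, A i) × (Fin n → Mood)) := by
  have hA := pi_prod_mem_stdSimplex
    (fun i => actionProb_mem_stdSimplex (A := A) hc hε i (z.2 i) (z.1 i))
  have hM := fun a' => pi_prod_mem_stdSimplex
    (fun i => moodProb_mem_stdSimplex hε hu i (z.2 i) z.1 a')
  refine ⟨fun z' => mul_nonneg (hA.1 z'.1) ((hM z'.1).1 z'.2), ?_⟩
  rw [Fintype.sum_prod_type]
  simp only [moodKernel, ← Finset.mul_sum]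
  rw [← hA.2]
  refine Finset.sum_congr rfl fun a' _ => ?_
  rw [(hM a').2, mul_one]

/-- The rule can go from everywhere to everywhere in two steps. -/
theorem moodKernel_two_step_pos [∀ i, Nontrivial (A i)] [Nonempty (Fin n)] {c ε : ℝ} (hc : 0 < c)
    (hε : ε ∈ Set.Ioo (0 : ℝ) 1) {u : Fin n → (∀ i, A i) → ℝ} (hu : ∀ i a, u i a < 1)
    (z z' : (∀ i, A i) × (Fin n → Mood)) :
    0 < ∑ w, moodKernel c ε u z w * moodKernel c ε u w z' := by
  have : Nontrivial (∀ i, A i) := Pi.nontrivial_at (Classical.arbitrary (Fin n))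
  -- The intermediate state has all agents discontent at a joint action different from `z.1`.
  -- Changing the action makes every mood possible, and discontent agents can reach every state in
  -- one step. A single step is not enough, since content agents who repeat the joint action stay
  -- content.
  obtain ⟨a, ha⟩ := exists_ne z.1
  have hK := fun w => moodKernel_mem_stdSimplex hc.le hε (fun i a => (hu i a).le) w
  refine Finset.sum_pos' (fun w _ => mul_nonneg ((hK z).1 w) ((hK w).1 z'))
    ⟨(a, fun _ => Mood.discontent), Finset.mem_univ _, mul_pos (mul_pos ?_ ?_) (mul_pos ?_ ?_)⟩
  · exact Finset.prod_pos fun i _ => actionProb_pos hc hε _ _ _ _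
  · exact Finset.prod_pos fun i _ => moodProb_pos hε hu (fun h => ha h.2) _
  · exact Finset.prod_pos fun i _ => actionProb_pos hc hε _ _ _ _
  · exact Finset.prod_pos fun i _ => moodProb_pos hε hu (fun h => by simp at h) _

/-- Factor out the larger power, which is at most `1`, and apply `1 + x ≤ exp x`. For fixed `ε` this
makes the kernel Lipschitz in the payoffs. -/
theorem abs_rpow_sub_rpow_le {ε : ℝ} (hε : ε ∈ Set.Ioo (0 : ℝ) 1) {x y : ℝ} (hx : 0 ≤ x)
    (hy : 0 ≤ y) : |ε ^ x - ε ^ y| ≤ |Real.log ε| * |x - y| := by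
  wlog h : x ≤ y generalizing x y
  · rw [abs_sub_comm, abs_sub_comm x y]
    exact this hy hx (le_of_not_ge h)
  have hlog : Real.log ε < 0 := Real.log_neg hε.1 hε.2
  have h1 : ε ^ y = ε ^ x * ε ^ (y - x) := by rw [← Real.rpow_add hε.1]; ring_nf
  have h2 : ε ^ x ≤ 1 := Real.rpow_le_one hε.1.le hε.2.le hx
  have h3 : 0 ≤ ε ^ x := Real.rpow_nonneg hε.1.le x
  have h4 : ε ^ (y - x) ≤ 1 := Real.rpow_le_one hε.1.le hε.2.le (by linarith)
  have h5 : Real.log ε * (y - x) + 1 ≤ ε ^ (y - x) := by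
    rw [Real.rpow_def_of_pos hε.1]
    exact Real.add_one_le_exp _
  rw [h1, abs_of_nonneg (by nlinarith), abs_of_neg hlog, abs_sub_comm, abs_of_nonneg (by linarith)]
  nlinarith

theorem abs_moodProb_sub_le {ε : ℝ} (hε : ε ∈ Set.Ioo (0 : ℝ) 1)
    {u v : Fin n → (∀ i, A i) → ℝ} (hu : ∀ i a, u i a ≤ 1) (hv : ∀ i a, v i a ≤ 1)
    (i : Fin n) (m : Mood) (a a' : ∀ i, A i) (m' : Mood) :
    |moodProb ε u i m a a' m' - moodProb ε v i m a a' m'| ≤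
      |Real.log ε| * |u i a' - v i a'| := by
  by_cases h : m = Mood.content ∧ a' = a
  · simp only [moodProb, if_pos h, sub_self, abs_zero]
    positivity
  · have h1 := abs_rpow_sub_rpow_le hε (x := 1 - u i a') (y := 1 - v i a')
      (by linarith [hu i a']) (by linarith [hv i a'])
    rw [show 1 - u i a' - (1 - v i a') = -(u i a' - v i a') by ring, abs_neg] at h1
    cases m' <;> simp only [moodProb, if_neg h]
    · exact h1
    · rwa [sub_sub_sub_cancel_left, abs_sub_comm]

theorem abs_le_one_of_mem_stdSimplex {ι : Type*} [Fintype ι] {p : ι → ℝ}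
    (hp : p ∈ stdSimplex ℝ ι) (x : ι) : |p x| ≤ 1 := by
  rw [abs_of_nonneg (hp.1 x), ← hp.2]
  exact Finset.single_le_sum (fun y _ => hp.1 y) (Finset.mem_univ x)

theorem abs_moodKernel_sub_le [∀ i, Nontrivial (A i)] {c ε : ℝ} (hc : 0 ≤ c)
    (hε : ε ∈ Set.Ioo (0 : ℝ) 1) {u v : Fin n → (∀ i, A i) → ℝ} (hu : ∀ i a, u i a ≤ 1)
    (hv : ∀ i a, v i a ≤ 1) (z z' : (∀ i, A i) × (Fin n → Mood)) :
    |moodKernel c ε u z z' - moodKernel c ε v z z'| ≤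
      |Real.log ε| * ∑ i, |u i z'.1 - v i z'.1| := by
  have hA := pi_prod_mem_stdSimplex
    (fun i => actionProb_mem_stdSimplex (A := A) hc hε i (z.2 i) (z.1 i))
  rw [moodKernel, moodKernel, ← mul_sub, abs_mul]
  refine (mul_le_of_le_one_left (abs_nonneg _)
    (abs_le_one_of_mem_stdSimplex hA z'.1)).trans ?_
  refine (abs_prod_sub_prod_le _ (fun i _ => ?_) fun i _ => ?_).trans ?_
  · exact abs_le_one_of_mem_stdSimplex (moodProb_mem_stdSimplex hε hu i (z.2 i) z.1 z'.1) _
  · exact abs_le_one_of_mem_stdSimplex (moodProb_mem_stdSimplex hε hv i (z.2 i) z.1 z'.1) _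
  · rw [Finset.mul_sum]
    exact Finset.sum_le_sum fun i _ => abs_moodProb_sub_le hε hu hv _ _ _ _ _

end NormalForm

namespace NormalForm

variable {n : ℕ} {A : Fin n → Type*} [∀ i, Fintype (A i)] [∀ i, DecidableEq (A i)]

/-! ### The stationary distribution for a small rate of mistakes -/

/-- The exponent of the probability that exactly the agents that are content in `ξ` become content
at the joint action `b`. -/
noncomputable def contentCost (u : Fin n → (∀ i, A i) → ℝ) (b : ∀ i, A i) (ξ : Fin n → Mood) : ℝ :=
  ∑ i, if ξ i = Mood.content then 1 - u i b else 0

/-- Probability that the joint action changes from `a` to `b` when the moods are `ξ`. -/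
noncomputable def jointActionProb (c ε : ℝ) (ξ : Fin n → Mood) (a b : ∀ i, A i) : ℝ :=
  ∏ i, actionProb c ε i (ξ i) (a i) (b i)

/-- Probability that the moods change from `ξ` to `ξ'` when the joint action `b` is repeated. -/
noncomputable def jointMoodProb (ε : ℝ) (u : Fin n → (∀ i, A i) → ℝ) (b : ∀ i, A i)
    (ξ ξ' : Fin n → Mood) : ℝ :=
  ∏ i, moodProb ε u i (ξ i) b b (ξ' i)

/-- The probability flow into the joint action `b` from the other joint actions. -/
noncomputable def inflow (c ε : ℝ) (p : (∀ i, A i) × (Fin n → Mood) → ℝ) (b : ∀ i, A i) : ℝ :=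
  ∑ a ∈ Finset.univ.erase b, ∑ ξ, p (a, ξ) * jointActionProb c ε ξ a b

/-- A change of joint action erases the memory of the moods: everyone draws a new mood as a
discontent agent would. Hence all the mass arriving from elsewhere can be collected in the single
number `inflow`. -/
theorem balance {c ε : ℝ} {u : Fin n → (∀ i, A i) → ℝ} {p : (∀ i, A i) × (Fin n → Mood) → ℝ}
    (hp : FiniteChain.IsStationary (moodKernel c ε u) p) (b : ∀ i, A i) (ξ' : Fin n → Mood) :
    p (b, ξ') = inflow c ε p b * jointMoodProb ε u b (fun _ => Mood.discontent) ξ' +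
      ∑ ξ, p (b, ξ) * jointActionProb c ε ξ b b * jointMoodProb ε u b ξ ξ' := by
  rw [← hp.2 (b, ξ'), Fintype.sum_prod_type, ← Finset.sum_erase_add _ _ (Finset.mem_univ b),
    inflow, Finset.sum_mul]
  congr 1
  · refine Finset.sum_congr rfl fun a ha => ?_
    rw [Finset.sum_mul]
    refine Finset.sum_congr rfl fun ξ _ => ?_
    rw [moodKernel, ← mul_assoc]
    congr 1
    refine Finset.prod_congr rfl fun i _ => ?_
    exact moodProb_of_not (fun h => Finset.ne_of_mem_erase ha h.2.symm) _
  · refine Finset.sum_congr rfl fun ξ _ => ?_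
    rw [moodKernel, ← mul_assoc]
    rfl

variable {u : ℝ → Fin n → (∀ i, A i) → ℝ} {u₀ : Fin n → (∀ i, A i) → ℝ}

/-- The power of `ε` lost in becoming content acts as a potential: once it is divided out, every
mood change has limit `1`, except content to discontent, which is impossible. The case discontent to
content is `PolyTendsto.rpow_sub`. -/
theorem moodProb_asymptotics {i : Fin n} {b : ∀ i, A i}
    (hu : PolyTendsto (fun ε => u ε i b) (u₀ i b)) (hu₀ : u₀ i b < 1) (m m' : Mood) :
    ∃ g, PolyTendsto g (if m = Mood.content → m' = Mood.content then 1 else 0) ∧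
      ∀ ε > 0, ε ^ (if m = Mood.content then 1 - u₀ i b else 0) * moodProb ε (u ε) i m b b m' =
        ε ^ (if m' = Mood.content then 1 - u₀ i b else 0) * g ε := by
  have hsub := hu.rpow_sub
  have hrw : ∀ ε > 0, ε ^ (1 - u ε i b) = ε ^ (1 - u₀ i b) * ε ^ (u₀ i b - u ε i b) := by
    intro ε hε
    rw [← Real.rpow_add hε]
    ring_nf
  cases m <;> cases m'
  · exact ⟨fun _ => 1, by simpa using PolyTendsto.const 1, by simp [moodProb]⟩
  · exact ⟨fun _ => 0, by simpa using PolyTendsto.const 0, by simp [moodProb]⟩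
  · refine ⟨_, by simpa using hsub, fun ε hε => ?_⟩
    simp [moodProb, hrw ε hε]
  · refine ⟨fun ε => 1 - ε ^ (1 - u ε i b), ?_, fun ε hε => by simp [moodProb]⟩
    have h1 := (PolyTendsto.rpow_pos (sub_pos.2 hu₀)).mul hsub
    have h2 := (PolyTendsto.const 1).sub h1
    simp only [zero_mul, sub_zero] at h2
    simp only [reduceCtorEq, imp_false, not_false_eq_true, if_true]
    refine h2.congr' ?_
    filter_upwards [self_mem_nhdsWithin] with ε hε
    rw [hrw ε hε]

theorem jointMoodProb_asymptotics (hu : ∀ i a, PolyTendsto (fun ε => u ε i a) (u₀ i a))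
    (hu₀ : ∀ i a, u₀ i a < 1) (b : ∀ i, A i) (ξ ξ' : Fin n → Mood) :
    ∃ g, PolyTendsto g (if ∀ i, ξ i = Mood.content → ξ' i = Mood.content then 1 else 0) ∧
      ∀ ε > 0, ε ^ contentCost u₀ b ξ * jointMoodProb ε (u ε) b ξ ξ' =
        ε ^ contentCost u₀ b ξ' * g ε := by
  choose g hg hg' using fun i => moodProb_asymptotics (hu i b) (hu₀ i b) (ξ i) (ξ' i)
  refine ⟨fun ε => ∏ i, g i ε, ?_, fun ε hε => ?_⟩
  · have := PolyTendsto.prod Finset.univ fun i _ => hg i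
    rw [Finset.prod_boole] at this
    convert this using 2
    simp
  · rw [contentCost, contentCost, Real.rpow_sum_of_pos hε, Real.rpow_sum_of_pos hε, jointMoodProb,
      ← Finset.prod_mul_distrib, ← Finset.prod_mul_distrib]
    exact Finset.prod_congr rfl fun i _ => hg' i ε hε

/-- The probability of repeating a joint action, in the limit of no mistakes. -/
noncomputable def repeatProb (A : Fin n → Type*) [∀ i, Fintype (A i)] (ξ : Fin n → Mood) : ℝ :=
  ∏ i, if ξ i = Mood.content then 1 else 1 / (Fintype.card (A i) : ℝ)

theorem actionProb_asymptotics {c : ℝ} (hc : 0 < c) (i : Fin n) (m : Mood) (b b' : A i) :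
    PolyTendsto (fun ε => actionProb c ε i m b b')
      (if m = Mood.content then if b' = b then 1 else 0 else 1 / (Fintype.card (A i) : ℝ)) := by
  cases m with
  | discontent => simpa [actionProb] using PolyTendsto.const (1 / (Fintype.card (A i) : ℝ))
  | content =>
    have h := PolyTendsto.rpow_pos hc
    simp only [actionProb, if_true]
    split_ifs with hb
    · simpa using (PolyTendsto.const 1).sub h
    · simpa [div_eq_mul_inv] using h.mul (PolyTendsto.const ((Fintype.card (A i) : ℝ) - 1)⁻¹)

theorem jointActionProb_repeat {c : ℝ} (hc : 0 < c) (ξ : Fin n → Mood) (b : ∀ i, A i) :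
    PolyTendsto (fun ε => jointActionProb c ε ξ b b) (repeatProb A ξ) := by
  have := PolyTendsto.prod Finset.univ fun i _ => actionProb_asymptotics hc i (ξ i) (b i) (b i)
  simpa [jointActionProb, repeatProb] using this

theorem repeatProb_nonneg (ξ : Fin n → Mood) : 0 ≤ repeatProb A ξ :=
  Finset.prod_nonneg fun i _ => by split_ifs <;> positivity

theorem repeatProb_lt_one [∀ i, Nontrivial (A i)] {ξ : Fin n → Mood}
    (hξ : ξ ≠ fun _ => Mood.content) : repeatProb A ξ < 1 := by
  obtain ⟨i, hi⟩ := Function.ne_iff.1 hξ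
  have h1 : ∀ j, 1 / (Fintype.card (A j) : ℝ) < 1 := fun j =>
    (div_lt_one (zero_lt_one.trans (one_lt_card j))).2 (one_lt_card j)
  rw [repeatProb, ← Finset.mul_prod_erase _ _ (Finset.mem_univ i), if_neg hi]
  refine (mul_le_of_le_one_right (by positivity) (Finset.prod_le_one (fun j _ => ?_)
    fun j _ => ?_)).trans_lt (h1 i)
  · split_ifs <;> positivity
  · split_ifs
    · exact le_rfl
    · exact (h1 j).le

/-- The probability of leaving a joint action, if all agents are content; `1` otherwise. -/
noncomputable def leaveFactor (c : ℝ) (ξ : Fin n → Mood) (ε : ℝ) : ℝ :=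
  if ξ = fun _ => Mood.content then 1 - (1 - ε ^ c) ^ n else 1

theorem jointActionProb_content_self (c ε : ℝ) (b : ∀ i, A i) :
    jointActionProb c ε (fun _ => Mood.content) b b = (1 - ε ^ c) ^ n := by
  simp [jointActionProb, actionProb]

theorem jointMoodProb_content_self (ε : ℝ) (u : Fin n → (∀ i, A i) → ℝ) (b : ∀ i, A i) :
    jointMoodProb ε u b (fun _ => Mood.content) (fun _ => Mood.content) = 1 := by
  simp [jointMoodProb, moodProb]

theorem jointMoodProb_eq_zero {ε : ℝ} {u : Fin n → (∀ i, A i) → ℝ} {b : ∀ i, A i}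
    {ξ ξ' : Fin n → Mood} (h : ¬ ∀ i, ξ i = Mood.content → ξ' i = Mood.content) :
    jointMoodProb ε u b ξ ξ' = 0 := by
  push Not at h
  obtain ⟨i, h1, h2⟩ := h
  exact Finset.prod_eq_zero (Finset.mem_univ i) (by simp [moodProb, h1, h2])

/-- The time spent in the moods `ξ` per visit of the joint action `b`. -/
theorem stationary_asymptotics [∀ i, Nontrivial (A i)] {c : ℝ} (hc : 0 < c)
    (hu : ∀ i a, PolyTendsto (fun ε => u ε i a) (u₀ i a)) (hu₀ : ∀ i a, u₀ i a < 1)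
    {p : ℝ → (∀ i, A i) × (Fin n → Mood) → ℝ}
    (hp : ∀ᶠ ε in 𝓝[>] 0, FiniteChain.IsStationary (moodKernel c ε (u ε)) (p ε))
    (ξ' : Fin n → Mood) :
    ∃ l > 0, ∀ b, ∃ k, PolyTendsto k l ∧ ∀ᶠ ε in 𝓝[>] 0,
      p ε (b, ξ') * leaveFactor c ξ' ε =
        inflow c ε (p ε) b * (ε ^ contentCost u₀ b ξ' * k ε) := by
  -- Induction on the number of content agents. In the balance equation at `b`, the profile `ξ'` is
  -- fed by the inflow, by itself, and by the profiles in `L`, whose sets of content agents are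
  -- strictly smaller.
  induction hN : (Finset.univ.filter fun i => ξ' i = Mood.content).card using
    Nat.strong_induction_on generalizing ξ' with
  | _ N ih =>
  subst hN
  set L : Finset (Fin n → Mood) := Finset.univ.filter fun ξ =>
    ξ ≠ ξ' ∧ ∀ i, ξ i = Mood.content → ξ' i = Mood.content with hL
  have hLlt : ∀ ξ ∈ L, (Finset.univ.filter fun i => ξ i = Mood.content).card <
      (Finset.univ.filter fun i => ξ' i = Mood.content).card := by
    intro ξ hξ
    obtain ⟨h1, h2⟩ := (Finset.mem_filter.1 hξ).2
    refine Finset.card_lt_card ⟨fun i hi => by simpa using h2 i (by simpa using hi), fun h => h1 ?_⟩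
    ext i
    by_cases hi : ξ' i = Mood.content
    · have := h (Finset.mem_filter.2 ⟨Finset.mem_univ i, hi⟩)
      rw [hi, (Finset.mem_filter.1 this).2]
    · rw [Mood.eq_discontent_of_ne hi, Mood.eq_discontent_of_ne fun h' => hi (h2 i h')]
  have hLc : ∀ ξ ∈ L, ∀ ε, leaveFactor c ξ ε = 1 := by
    intro ξ hξ ε
    obtain ⟨h1, h2⟩ := (Finset.mem_filter.1 hξ).2
    refine if_neg fun h => h1 ?_
    rw [h] at h2 ⊢
    exact funext fun i => (h2 i rfl).symm
  choose l hl k hk hk' using fun ξ : L => ih _ (hLlt ξ ξ.2) ξ.1 rfl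
  have hlpos : 0 < 1 + ∑ ξ : L, l ξ * repeatProb A ξ.1 := by
    have : 0 ≤ ∑ ξ : L, l ξ * repeatProb A ξ.1 :=
      Finset.sum_nonneg fun ξ _ => mul_nonneg (hl ξ).le (repeatProb_nonneg _)
    linarith
  -- The self-loop of `ξ'` is moved to the left. All other terms carry the same power of `ε`, and
  -- the limit of the coefficient involves no payoff, hence no `b`.
  have main : ∀ b, ∃ k', PolyTendsto k' (1 + ∑ ξ : L, l ξ * repeatProb A ξ.1) ∧
      ∀ᶠ ε in 𝓝[>] 0, p ε (b, ξ') *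
        (1 - jointActionProb c ε ξ' b b * jointMoodProb ε (u ε) b ξ' ξ') =
        inflow c ε (p ε) b * (ε ^ contentCost u₀ b ξ' * k' ε) := by
    intro b
    obtain ⟨g, hg, hg'⟩ :=
      jointMoodProb_asymptotics hu hu₀ b (fun _ => Mood.discontent) ξ'
    choose G hG hG' using fun ξ => jointMoodProb_asymptotics hu hu₀ b ξ ξ'
    rw [if_pos (by simp)] at hg
    refine ⟨fun ε => g ε + ∑ ξ : L, k ξ b ε * jointActionProb c ε ξ.1 b b * G ξ.1 ε, ?_, ?_⟩
    · refine hg.add (PolyTendsto.sum _ fun ξ _ => ?_)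
      have h1 := hG ξ.1
      rw [if_pos (Finset.mem_filter.1 ξ.2).2.2] at h1
      simpa using ((hk ξ b).mul (jointActionProb_repeat hc ξ.1 b)).mul h1
    · have hall : ∀ᶠ ε in 𝓝[>] 0, ∀ ξ : L, p ε (b, ξ.1) * leaveFactor c ξ.1 ε =
          inflow c ε (p ε) b * (ε ^ contentCost u₀ b ξ.1 * k ξ b ε) :=
        eventually_all.2 fun ξ => hk' ξ b
      filter_upwards [hp, hall, self_mem_nhdsWithin] with ε h1 h2 h3
      have h4 := balance h1 b ξ'
      have h5 : ∑ ξ, p ε (b, ξ) * jointActionProb c ε ξ b b * jointMoodProb ε (u ε) b ξ ξ' =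
          p ε (b, ξ') * jointActionProb c ε ξ' b b * jointMoodProb ε (u ε) b ξ' ξ' +
          ∑ ξ : L, p ε (b, ξ.1) * jointActionProb c ε ξ.1 b b *
            jointMoodProb ε (u ε) b ξ.1 ξ' := by
        rw [← Finset.add_sum_erase _ _ (Finset.mem_univ ξ')]
        congr 1
        rw [Finset.sum_coe_sort L (fun ξ => p ε (b, ξ) * jointActionProb c ε ξ b b *
            jointMoodProb ε (u ε) b ξ ξ')]
        symm
        refine Finset.sum_subset (fun ξ hξ => ?_) fun ξ h6 h7 => ?_
        · exact Finset.mem_erase.2 ⟨(Finset.mem_filter.1 hξ).2.1, Finset.mem_univ _⟩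
        · rw [jointMoodProb_eq_zero, mul_zero]
          intro h8
          exact h7 (Finset.mem_filter.2 ⟨Finset.mem_univ _, Finset.ne_of_mem_erase h6, h8⟩)
      have h6 : contentCost u₀ b (fun _ => Mood.discontent) = 0 := by simp [contentCost]
      have h7 := hg' ε h3
      rw [h6, Real.rpow_zero, one_mul] at h7
      rw [h5] at h4
      have h8 : ∑ ξ : L, p ε (b, ξ.1) * jointActionProb c ε ξ.1 b b *
            jointMoodProb ε (u ε) b ξ.1 ξ' = inflow c ε (p ε) b * (ε ^ contentCost u₀ b ξ' *
            ∑ ξ : L, k ξ b ε * jointActionProb c ε ξ.1 b b * G ξ.1 ε) := by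
        rw [Finset.mul_sum, Finset.mul_sum]
        refine Finset.sum_congr rfl fun ξ _ => ?_
        have h9 := h2 ξ
        rw [hLc _ ξ.2, mul_one] at h9
        rw [h9]
        linear_combination (inflow c ε (p ε) b * k ξ b ε * jointActionProb c ε ξ.1 b b) *
          hG' ξ.1 ε h3
      rw [h8, h7] at h4
      linear_combination h4
  -- If all agents are content, one minus the self-loop tends to `0` and is exactly `leaveFactor`,
  -- so it stays on the left. Otherwise its limit is positive and can be divided out.
  by_cases hξ : ξ' = fun _ => Mood.content
  · refine ⟨_, hlpos, fun b => ?_⟩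
    obtain ⟨k', hk1, hk2⟩ := main b
    refine ⟨k', hk1, ?_⟩
    filter_upwards [hk2] with ε h
    rw [← h, leaveFactor, if_pos hξ, hξ, jointActionProb_content_self, jointMoodProb_content_self,
      mul_one]
  · have h1 := sub_pos.2 (repeatProb_lt_one (A := A) hξ)
    refine ⟨_, div_pos hlpos h1, fun b => ?_⟩
    obtain ⟨k', hk1, hk2⟩ := main b
    obtain ⟨g, hg, hg'⟩ := jointMoodProb_asymptotics hu hu₀ b ξ' ξ'
    rw [if_pos fun _ h => h] at hg
    have h2 : PolyTendsto (fun ε => 1 - jointActionProb c ε ξ' b b * g ε)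
        (1 - repeatProb A ξ') := by
      simpa using (PolyTendsto.const 1).sub ((jointActionProb_repeat hc ξ' b).mul hg)
    refine ⟨_, hk1.div h2 h1.ne', ?_⟩
    filter_upwards [hk2, self_mem_nhdsWithin, h2.tendsto.eventually_ne h1.ne'] with ε h3 h4 h5
    have h6 : jointMoodProb ε (u ε) b ξ' ξ' = g ε :=
      mul_left_cancel₀ (Real.rpow_pos_of_pos h4 _).ne' (hg' ε h4)
    rw [h6] at h3
    rw [leaveFactor, if_neg hξ, mul_one]
    field_simp
    linear_combination h3

end NormalForm

/-! ### Flows between joint actions, and the limit of the stationary distribution -/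

namespace NormalForm

variable {n : ℕ} {A : Fin n → Type*} [∀ i, Fintype (A i)] [∀ i, DecidableEq (A i)]
  {u : ℝ → Fin n → (∀ i, A i) → ℝ} {u₀ : Fin n → (∀ i, A i) → ℝ}

theorem jointActionProb_mem_stdSimplex [∀ i, Nontrivial (A i)] {c ε : ℝ} (hc : 0 ≤ c)
    (hε : ε ∈ Set.Ioo (0 : ℝ) 1) (ξ : Fin n → Mood) (a : ∀ i, A i) :
    jointActionProb c ε ξ a ∈ stdSimplex ℝ (∀ i, A i) :=
  pi_prod_mem_stdSimplex (fun i => actionProb_mem_stdSimplex (A := A) hc hε i (ξ i) (a i))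

theorem eventually_stationary_pos [∀ i, Nontrivial (A i)] [Nonempty (Fin n)] {c : ℝ} (hc : 0 < c)
    (hu : ∀ i a, PolyTendsto (fun ε => u ε i a) (u₀ i a)) (hu₀ : ∀ i a, u₀ i a < 1)
    {p : ℝ → (∀ i, A i) × (Fin n → Mood) → ℝ}
    (hp : ∀ᶠ ε in 𝓝[>] 0, FiniteChain.IsStationary (moodKernel c ε (u ε)) (p ε)) :
    ∀ᶠ ε in 𝓝[>] 0, ∀ z, 0 < p ε z := by
  have h1 : ∀ᶠ ε in 𝓝[>] 0, ∀ i a, u ε i a < 1 :=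
    eventually_all.2 fun i => eventually_all.2 fun a =>
      (hu i a).tendsto.eventually (gt_mem_nhds (hu₀ i a))
  filter_upwards [hp, h1, Ioo_mem_nhdsGT (zero_lt_one' ℝ)] with ε h2 h3 h4
  exact h2.pos (moodKernel_two_step_pos hc h4 h3)

/-- Only the all-discontent profile has cost zero; every other one contributes a positive power of
`ε`, as limit payoffs are below `1`. Discontent agents choose uniformly, so the fraction `q` of the
flow is the same for every target and every origin. -/
theorem transition_asymptotics [∀ i, Nontrivial (A i)] [Nonempty (Fin n)] {c : ℝ} (hc : 0 < c)
    (hu : ∀ i a, PolyTendsto (fun ε => u ε i a) (u₀ i a)) (hu₀ : ∀ i a, u₀ i a < 1)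
    {p : ℝ → (∀ i, A i) × (Fin n → Mood) → ℝ}
    (hp : ∀ᶠ ε in 𝓝[>] 0, FiniteChain.IsStationary (moodKernel c ε (u ε)) (p ε)) :
    ∃ q > 0, ∀ a b, a ≠ b → ∃ M, PolyTendsto M q ∧ ∀ᶠ ε in 𝓝[>] 0,
      ∑ ξ, p ε (a, ξ) * jointActionProb c ε ξ a b = inflow c ε (p ε) a * M ε := by
  classical
  obtain ⟨l, hl, hk⟩ := stationary_asymptotics hc hu hu₀ hp fun _ => Mood.discontent
  set r : ℝ := ∏ i, 1 / (Fintype.card (A i) : ℝ) with hr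
  have hrpos : 0 < r := Finset.prod_pos fun i _ =>
    div_pos one_pos (zero_lt_one.trans (one_lt_card i))
  have hDC : (fun _ : Fin n => Mood.discontent) ≠ fun _ => Mood.content := fun h => by
    simpa using congrFun h (Classical.arbitrary _)
  refine ⟨l * r, mul_pos hl hrpos, fun a b hab => ?_⟩
  have key : ∀ ξ : Fin n → Mood, ∃ M, PolyTendsto M
      (if ξ = fun _ => Mood.discontent then l * r else 0) ∧ ∀ᶠ ε in 𝓝[>] 0,
        p ε (a, ξ) * jointActionProb c ε ξ a b = inflow c ε (p ε) a * M ε := by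
    intro ξ
    by_cases hD : ξ = fun _ => Mood.discontent
    · obtain ⟨k, hk1, hk2⟩ := hk a
      refine ⟨fun ε => k ε * r, ?_, ?_⟩
      · rw [if_pos hD]
        exact hk1.mul (PolyTendsto.const r)
      · filter_upwards [hk2] with ε h
        rw [leaveFactor, if_neg hDC, mul_one] at h
        rw [hD, h]
        have : jointActionProb c ε (fun _ => Mood.discontent) a b = r := by
          simp [jointActionProb, actionProb, hr]
        rw [this]
        simp only [contentCost, reduceCtorEq, if_false, Finset.sum_const_zero, Real.rpow_zero]
        ring
    · obtain ⟨l', -, hk'⟩ := stationary_asymptotics hc hu hu₀ hp ξ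
      obtain ⟨k, hk1, hk2⟩ := hk' a
      have hT : 0 < contentCost u₀ a ξ := by
        obtain ⟨i, hi⟩ := Function.ne_iff.1 hD
        have hi : ξ i = Mood.content := by
          by_contra h
          exact hi (Mood.eq_discontent_of_ne h)
        refine Finset.sum_pos' (fun j _ => ?_) ⟨i, Finset.mem_univ i, ?_⟩
        · split_ifs
          · linarith [hu₀ j a]
          · exact le_rfl
        · rw [if_pos hi]
          linarith [hu₀ i a]
      have h1 := (PolyTendsto.rpow_pos hT).mul hk1
      rw [zero_mul] at h1
      rw [if_neg hD]
      -- The long stay of an all-content profile is offset by its small chance of leaving: moving to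
      -- the particular action `b ≠ a` is at most as likely as leaving `a`, so the quotient below is
      -- bounded by `1`.
      have hlf : ∀ ε ∈ Set.Ioo (0 : ℝ) 1, 0 < leaveFactor c ξ ε ∧
          jointActionProb c ε ξ a b ≤ leaveFactor c ξ ε := by
        intro ε hε
        have h2 := jointActionProb_mem_stdSimplex (A := A) hc.le hε ξ a
        rw [leaveFactor]
        split_ifs with hC
        · have h3 : ε ^ c < 1 := Real.rpow_lt_one hε.1.le hε.2 hc
          have h4 : 0 < ε ^ c := Real.rpow_pos_of_pos hε.1 c
          have hn : n ≠ 0 := fun h => by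
            subst h
            exact IsEmpty.false (Classical.arbitrary (Fin 0))
          refine ⟨sub_pos.2 (pow_lt_one₀ (by linarith) (by linarith) hn), ?_⟩
          have h5 : jointActionProb c ε ξ a a + jointActionProb c ε ξ a b ≤ 1 := by
            rw [← h2.2, ← Finset.sum_pair hab]
            exact Finset.sum_le_univ_sum_of_nonneg h2.1
          have h6 := jointActionProb_content_self c ε a
          rw [← hC] at h6
          linarith
        · exact ⟨one_pos, (le_abs_self _).trans (abs_le_one_of_mem_stdSimplex h2 b)⟩
      refine ⟨_, h1.zero_mul_bounded
        (g := fun ε => jointActionProb c ε ξ a b / leaveFactor c ξ ε) ?_, ?_⟩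
      · refine Asymptotics.IsBigO.of_bound 1 ?_
        filter_upwards [Ioo_mem_nhdsGT (zero_lt_one' ℝ)] with ε hε
        have h2 := jointActionProb_mem_stdSimplex (A := A) hc.le hε ξ a
        obtain ⟨h3, h4⟩ := hlf ε hε
        rw [Real.norm_of_nonneg (div_nonneg (h2.1 b) h3.le), norm_one, one_mul]
        exact div_le_one_of_le₀ h4 h3.le
      · filter_upwards [hk2, Ioo_mem_nhdsGT (zero_lt_one' ℝ)] with ε h2 hε
        have h3 := (hlf ε hε).1.ne'
        field_simp
        linear_combination (jointActionProb c ε ξ a b) * h2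
  choose M hM hM' using key
  refine ⟨fun ε => ∑ ξ, M ξ ε, ?_, ?_⟩
  · have := PolyTendsto.sum Finset.univ fun ξ _ => hM ξ
    simpa using this
  · filter_upwards [eventually_all.2 hM'] with ε h
    rw [Finset.mul_sum]
    exact Finset.sum_congr rfl fun ξ _ => h ξ

/-- All joint actions are visited equally often, in the limit of no mistakes. -/
theorem inflow_asymptotics [∀ i, Nontrivial (A i)] [Nonempty (Fin n)] {c : ℝ} (hc : 0 < c)
    (hu : ∀ i a, PolyTendsto (fun ε => u ε i a) (u₀ i a)) (hu₀ : ∀ i a, u₀ i a < 1)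
    {p : ℝ → (∀ i, A i) × (Fin n → Mood) → ℝ}
    (hp : ∀ᶠ ε in 𝓝[>] 0, FiniteChain.IsStationary (moodKernel c ε (u ε)) (p ε)) :
    ∃ q > 0, (∀ᶠ ε in 𝓝[>] 0, 0 < ∑ b, inflow c ε (p ε) b) ∧
      ∀ b, PolyTendsto (fun ε => inflow c ε (p ε) b / ∑ b, inflow c ε (p ε) b) q := by
  obtain ⟨q, hq, hM⟩ := transition_asymptotics hc hu hu₀ hp
  have : Nontrivial (∀ i, A i) := Pi.nontrivial_at (Classical.arbitrary (Fin n))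
  have hpos : ∀ᶠ ε in 𝓝[>] 0, ∀ b, 0 < inflow c ε (p ε) b := by
    filter_upwards [eventually_stationary_pos hc hu hu₀ hp, Ioo_mem_nhdsGT (zero_lt_one' ℝ)]
      with ε h1 hε b
    obtain ⟨a, ha⟩ := exists_ne b
    have hterm : ∀ a ξ, 0 < p ε (a, ξ) * jointActionProb c ε ξ a b := fun a ξ =>
      mul_pos (h1 _) (Finset.prod_pos fun i _ => actionProb_pos hc hε _ _ _ _)
    exact Finset.sum_pos (fun a _ => Finset.sum_pos (fun ξ _ => hterm a ξ)
        ⟨fun _ => Mood.content, Finset.mem_univ _⟩)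
      ⟨a, Finset.mem_erase.2 ⟨ha, Finset.mem_univ a⟩⟩
  have hsum : ∀ᶠ ε in 𝓝[>] 0, 0 < ∑ b, inflow c ε (p ε) b := by
    filter_upwards [hpos] with ε h
    exact Finset.sum_pos (fun b _ => h b) Finset.univ_nonempty
  -- Up to an error, the share `x` of `b` is `q` times the sum of the other shares, so `x = q * (1 -
  -- x)`.
  refine ⟨q / (1 + q), by positivity, hsum, fun b => ?_⟩
  set η : (∀ i, A i) → ℝ → ℝ := fun a ε => inflow c ε (p ε) a / ∑ b, inflow c ε (p ε) b with hη
  have hηbd : ∀ a, η a =O[𝓝[>] 0] fun _ => (1 : ℝ) := by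
    intro a
    refine Asymptotics.IsBigO.of_bound 1 ?_
    filter_upwards [hpos, hsum] with ε h1 h2
    rw [Real.norm_of_nonneg (div_nonneg (h1 a).le h2.le), norm_one, one_mul]
    exact div_le_one_of_le₀ (Finset.single_le_sum (fun b _ => (h1 b).le) (Finset.mem_univ a)) h2.le
  have hM' : ∀ a, ∃ M, PolyTendsto M q ∧ ∀ᶠ ε in 𝓝[>] 0, a ≠ b →
      ∑ ξ, p ε (a, ξ) * jointActionProb c ε ξ a b = inflow c ε (p ε) a * M ε := by
    intro a
    by_cases hab : a = b
    · exact ⟨_, PolyTendsto.const q, Eventually.of_forall fun ε h => absurd hab h⟩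
    · obtain ⟨M, h1, h2⟩ := hM a b hab
      exact ⟨M, h1, h2.mono fun ε h _ => h⟩
  choose M hM1 hM2 using hM'
  have herr : PolyTendsto (fun ε => ∑ a ∈ Finset.univ.erase b, (M a ε - q) * η a ε) 0 := by
    have := PolyTendsto.sum (Finset.univ.erase b) fun a _ =>
      (hM1 a).sub_const.zero_mul_bounded (hηbd a)
    simpa using this
  have h1 := ((PolyTendsto.const q).add herr).div (PolyTendsto.const (1 + q)) (by positivity)
  rw [add_zero] at h1
  refine h1.congr' ?_
  filter_upwards [hsum, eventually_all.2 hM2] with ε h2 h3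
  have h4 : inflow c ε (p ε) b = ∑ a ∈ Finset.univ.erase b, inflow c ε (p ε) a * M a ε := by
    rw [inflow]
    exact Finset.sum_congr rfl fun a ha => h3 a (Finset.ne_of_mem_erase ha)
  have h5 : η b ε = ∑ a ∈ Finset.univ.erase b, η a ε * M a ε := by
    simp only [hη]
    rw [h4, Finset.sum_div]
    refine Finset.sum_congr rfl fun a _ => ?_
    ring
  have h6 : η b ε + ∑ a ∈ Finset.univ.erase b, η a ε = 1 := by
    rw [Finset.add_sum_erase _ (fun a => η a ε) (Finset.mem_univ b)]
    simp only [hη]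
    rw [← Finset.sum_div, div_self h2.ne']
  have h7 : ∑ a ∈ Finset.univ.erase b, (M a ε - q) * η a ε =
      η b ε - q * ∑ a ∈ Finset.univ.erase b, η a ε := by
    rw [h5, Finset.mul_sum, ← Finset.sum_sub_distrib]
    exact Finset.sum_congr rfl fun a _ => by ring
  have h8 : (1 + q) ≠ 0 := by positivity
  rw [h7]
  change _ = η b ε
  field_simp
  linear_combination (-q) * h6

/-- As the rate of mistakes vanishes, the stationary distribution of the mood-based rule converges
at a polynomial rate, and its limit is supported on the joint actions of maximal welfare. -/
theorem exists_stationary_limit [∀ i, Nontrivial (A i)] [Nonempty (Fin n)] {c : ℝ}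
    (hc : (n : ℝ) ≤ c) (hu : ∀ i a, PolyTendsto (fun ε => u ε i a) (u₀ i a))
    (hu₀ : ∀ i a, u₀ i a ∈ Set.Ico (0 : ℝ) 1)
    {p : ℝ → (∀ i, A i) × (Fin n → Mood) → ℝ}
    (hp : ∀ᶠ ε in 𝓝[>] 0, FiniteChain.IsStationary (moodKernel c ε (u ε)) (p ε)) :
    ∃ p₀ : (∀ i, A i) × (Fin n → Mood) → ℝ, (∀ z, PolyTendsto (fun ε => p ε z) (p₀ z)) ∧
      ∀ z, p₀ z ≠ 0 → ∀ b, ∑ i, u₀ i b ≤ ∑ i, u₀ i z.1 := by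
  classical
  have hn : 0 < n := Fin.pos_iff_nonempty.2 inferInstance
  have hn' : (0 : ℝ) < n := by exact_mod_cast hn
  have hc0 : 0 < c := hn'.trans_le hc
  obtain ⟨q, hq, hY, hη⟩ := inflow_asymptotics hc0 hu (fun i a => (hu₀ i a).2) hp
  obtain ⟨a₀, ha₀⟩ := Finite.exists_max fun b => ∑ i, u₀ i b
  -- The heaviest state, all agents content at `a₀`, has weight of order `ε ^ (-m)` relative to the
  -- total inflow. Multiplication by `ε ^ m` gives all weights finite limits, because `c ≥ n` makes
  -- `m` nonnegative.
  set m : ℝ := c - (n - ∑ i, u₀ i a₀) with hm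
  have hwelfare : ∀ b, 0 ≤ ∑ i, u₀ i b := fun b => Finset.sum_nonneg fun i _ => (hu₀ i b).1
  have hm0 : 0 ≤ m := by linarith [hwelfare a₀]
  have hcostC : ∀ b, contentCost u₀ b (fun _ => Mood.content) = n - ∑ i, u₀ i b := by
    intro b
    simp [contentCost]
  have hcost0 : ∀ b ξ, 0 ≤ contentCost u₀ b ξ := fun b ξ => Finset.sum_nonneg fun i _ => by
    split_ifs
    · linarith [(hu₀ i b).2]
    · exact le_rfl
  let C : Fin n → Mood := fun _ => Mood.content
  -- The geometric sum for `1 - (1 - x) ^ n` with `x = ε ^ c`.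
  have hleave : ∃ h, PolyTendsto h (n : ℝ) ∧ ∀ ε, leaveFactor c C ε = ε ^ c * h ε := by
    refine ⟨fun ε => ∑ j ∈ Finset.range n, (1 - ε ^ c) ^ j, ?_, fun ε => ?_⟩
    · have h1 := (PolyTendsto.const 1).sub (PolyTendsto.rpow_pos hc0)
      rw [sub_zero] at h1
      have h2 := PolyTendsto.sum (Finset.range n) fun j _ =>
        PolyTendsto.prod (Finset.range j) fun _ _ => h1
      simpa using h2
    · rw [leaveFactor, if_pos rfl]
      have := mul_neg_geom_sum (1 - ε ^ c) n
      rw [← this]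
      ring
  have key : ∀ z : (∀ i, A i) × (Fin n → Mood), ∃ l ≥ 0,
      PolyTendsto (fun ε => p ε z / (∑ b, inflow c ε (p ε) b) * ε ^ m) l ∧
      (l ≠ 0 → ∀ b, ∑ i, u₀ i b ≤ ∑ i, u₀ i z.1) ∧ (z = (a₀, C) → 0 < l) := by
    rintro ⟨b, ξ⟩
    obtain ⟨l, hl, hk⟩ := stationary_asymptotics hc0 hu (fun i a => (hu₀ i a).2) hp ξ
    obtain ⟨k, hk1, hk2⟩ := hk b
    by_cases hξ : ξ = C
    · obtain ⟨h, hh, hh'⟩ := hleave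
      have he : 0 ≤ ∑ i, u₀ i a₀ - ∑ i, u₀ i b := sub_nonneg.2 (ha₀ b)
      have h1 := (((hη b).mul (PolyTendsto.rpow he)).mul hk1).div hh hn'.ne'
      refine ⟨_, ?_, h1.congr' ?_, ?_, ?_⟩
      · have := hl.le
        split_ifs <;> positivity
      · filter_upwards [hk2, hY, self_mem_nhdsWithin, hh.tendsto.eventually_ne hn'.ne']
          with ε h2 h3 h4 h5
        rw [hξ] at h2
        rw [hh', hcostC] at h2
        have h6 : ε ^ (n - ∑ i, u₀ i b) * ε ^ m = ε ^ c * ε ^ (∑ i, u₀ i a₀ - ∑ i, u₀ i b) := by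
          rw [← Real.rpow_add h4, ← Real.rpow_add h4]
          congr 1
          rw [hm]
          ring
        have h7 : ε ^ c ≠ 0 := (Real.rpow_pos_of_pos h4 c).ne'
        rw [hξ]
        field_simp
        refine mul_left_cancel₀ h7 ?_
        linear_combination (-(ε ^ m)) * h2 - (inflow c ε (p ε) b * k ε) * h6
      · intro h2 b'
        by_cases h3 : ∑ i, u₀ i a₀ - ∑ i, u₀ i b = 0
        · linarith [ha₀ b']
        · rw [if_neg h3] at h2
          simp at h2
      · intro h2
        have hb : b = a₀ := (Prod.ext_iff.1 h2).1
        rw [hb]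
        simp only [sub_self, if_true]
        positivity
    · have he : 0 ≤ contentCost u₀ b ξ + m := add_nonneg (hcost0 b ξ) hm0
      have h1 := ((hη b).mul (PolyTendsto.rpow he)).mul hk1
      refine ⟨_, ?_, h1.congr' ?_, ?_, fun h2 => absurd (Prod.ext_iff.1 h2).2 hξ⟩
      · have := hl.le
        split_ifs <;> positivity
      · filter_upwards [hk2, hY, self_mem_nhdsWithin] with ε h2 h3 h4
        rw [leaveFactor, if_neg hξ, mul_one] at h2
        rw [h2, Real.rpow_add h4]
        ring
      · intro h2 b'
        by_cases h3 : contentCost u₀ b ξ + m = 0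
        -- In this boundary case other moods may survive. But `m = 0` and `c ≥ n` force the maximal
        -- welfare to be `0`, so all joint actions are maximal.
        · have h4 : m = 0 := by linarith [hcost0 b ξ]
          have h5 := hwelfare b
          have h6 := ha₀ b'
          linarith
        · rw [if_neg h3] at h2
          simp at h2
  choose l hl0 hl1 hl2 hl3 using key
  have hlpos : 0 < ∑ z, l z :=
    Finset.sum_pos' (fun z _ => hl0 z) ⟨(a₀, C), Finset.mem_univ _, hl3 _ rfl⟩
  refine ⟨fun z => l z / ∑ z, l z, fun z => ?_, fun z hz => hl2 z fun h => hz (by simp [h])⟩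
  -- As `p ε` has total mass `1`, it equals the rescaled weights divided by their sum.
  refine ((hl1 z).div (PolyTendsto.sum Finset.univ fun z _ => hl1 z) hlpos.ne').congr' ?_
  filter_upwards [hp, hY, self_mem_nhdsWithin] with ε h1 h2 h3
  have h4 : (0 : ℝ) < ε ^ m := Real.rpow_pos_of_pos h3 m
  rw [← Finset.sum_mul, ← Finset.sum_div, h1.1.2]
  field_simp

end NormalForm

/-! ### Expectations over the paths of a process with finitely many states -/

namespace FinitePath

variable {C : Type*}

/-- `F` depends only on the first `t + 1` terms of a path. -/
def Adapted {β : Type*} (t : ℕ) (F : (ℕ → C) → β) : Prop :=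
  ∀ x x', (∀ τ ≤ t, x τ = x' τ) → F x = F x'

/-- Extend a finite path by its last term. -/
def extend {t : ℕ} (y : Fin (t + 1) → C) : ℕ → C := fun τ => y ⟨min τ t, by omega⟩

theorem extend_snoc_of_le {t : ℕ} (y : Fin (t + 1) → C) (c : C) {τ : ℕ} (hτ : τ ≤ t) :
    extend (Fin.snoc y c : Fin (t + 2) → C) τ = extend y τ := by
  have h : (⟨min τ (t + 1), by omega⟩ : Fin (t + 2)) =
      Fin.castSucc (⟨min τ t, by omega⟩ : Fin (t + 1)) := by
    ext
    simp
    omega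
  rw [extend, h, Fin.snoc_castSucc]
  rfl

theorem extend_snoc_last {t : ℕ} (y : Fin (t + 1) → C) (c : C) :
    extend (Fin.snoc y c : Fin (t + 2) → C) (t + 1) = c := by
  have h : (⟨min (t + 1) (t + 1), by omega⟩ : Fin (t + 2)) = Fin.last (t + 1) := by
    ext
    simp
  rw [extend, h, Fin.snoc_last]

/-- The probability of `x 0, …, x t`, when `x 0` has the distribution `ν` and `κ t x` is the
conditional distribution of `x (t + 1)`. -/
def pathWeight (ν : C → ℝ) (κ : ℕ → (ℕ → C) → C → ℝ) (x : ℕ → C) : ℕ → ℝ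
  | 0 => ν (x 0)
  | t + 1 => pathWeight ν κ x t * κ t x (x (t + 1))

variable [Fintype C]

/-- The expectation of `F` over the paths `x 0, …, x t`. -/
def pathExp (ν : C → ℝ) (κ : ℕ → (ℕ → C) → C → ℝ) (t : ℕ) (F : (ℕ → C) → ℝ) : ℝ :=
  ∑ y : Fin (t + 1) → C, pathWeight ν κ (extend y) t * F (extend y)

/-- `ν` and `κ` are the initial distribution and the transition law of a process. -/
structure IsProcess (ν : C → ℝ) (κ : ℕ → (ℕ → C) → C → ℝ) : Prop where
  init_mem : ν ∈ stdSimplex ℝ C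
  mem : ∀ t x, κ t x ∈ stdSimplex ℝ C
  adapted : ∀ t, Adapted t (κ t)

variable {ν : C → ℝ} {κ : ℕ → (ℕ → C) → C → ℝ}

theorem IsProcess.pathWeight_nonneg (hκ : IsProcess ν κ) (x : ℕ → C) (t : ℕ) :
    0 ≤ pathWeight ν κ x t := by
  induction t with
  | zero => exact hκ.init_mem.1 _
  | succ t ih => exact mul_nonneg ih ((hκ.mem t x).1 _)

theorem IsProcess.pathWeight_congr (hκ : IsProcess ν κ) {t : ℕ} {x x' : ℕ → C}
    (h : ∀ τ ≤ t, x τ = x' τ) : pathWeight ν κ x t = pathWeight ν κ x' t := by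
  induction t with
  | zero => simp [pathWeight, h 0 le_rfl]
  | succ t ih =>
    simp only [pathWeight]
    rw [ih fun τ hτ => h τ (by omega), hκ.adapted t x x' fun τ hτ => h τ (by omega),
      h (t + 1) le_rfl]

theorem pathExp_add (t : ℕ) (F F' : (ℕ → C) → ℝ) :
    pathExp ν κ t (fun x => F x + F' x) = pathExp ν κ t F + pathExp ν κ t F' := by
  simp only [pathExp, mul_add, Finset.sum_add_distrib]

theorem pathExp_sub (t : ℕ) (F F' : (ℕ → C) → ℝ) :
    pathExp ν κ t (fun x => F x - F' x) = pathExp ν κ t F - pathExp ν κ t F' := by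
  simp only [pathExp, mul_sub, Finset.sum_sub_distrib]

theorem pathExp_const_mul (t : ℕ) (b : ℝ) (F : (ℕ → C) → ℝ) :
    pathExp ν κ t (fun x => b * F x) = b * pathExp ν κ t F := by
  simp only [pathExp, Finset.mul_sum]
  exact Finset.sum_congr rfl fun _ _ => by ring

theorem pathExp_sum {ι : Type*} (s : Finset ι) (t : ℕ) (F : ι → (ℕ → C) → ℝ) :
    pathExp ν κ t (fun x => ∑ i ∈ s, F i x) = ∑ i ∈ s, pathExp ν κ t (F i) := by
  simp only [pathExp, Finset.mul_sum]
  exact Finset.sum_comm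

theorem IsProcess.pathExp_mono (hκ : IsProcess ν κ) (t : ℕ) {F F' : (ℕ → C) → ℝ}
    (h : ∀ x, F x ≤ F' x) : pathExp ν κ t F ≤ pathExp ν κ t F' :=
  Finset.sum_le_sum fun _ _ => mul_le_mul_of_nonneg_left (h _) (hκ.pathWeight_nonneg _ _)

theorem IsProcess.abs_pathExp_le (hκ : IsProcess ν κ) (t : ℕ) (F : (ℕ → C) → ℝ) :
    |pathExp ν κ t F| ≤ pathExp ν κ t fun x => |F x| := by
  refine (Finset.abs_sum_le_sum_abs _ _).trans_eq (Finset.sum_congr rfl fun y _ => ?_)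
  rw [abs_mul, abs_of_nonneg (hκ.pathWeight_nonneg _ _)]

theorem IsProcess.pathExp_nonneg (hκ : IsProcess ν κ) (t : ℕ) {F : (ℕ → C) → ℝ}
    (h : ∀ x, 0 ≤ F x) : 0 ≤ pathExp ν κ t F :=
  Finset.sum_nonneg fun _ _ => mul_nonneg (hκ.pathWeight_nonneg _ _) (h _)

/-- The tower property: condition on the path up to time `t` and sum over its last term. -/
theorem IsProcess.pathExp_succ_mul (hκ : IsProcess ν κ) {t : ℕ} {F : (ℕ → C) → ℝ}
    (hF : Adapted t F) (g : C → ℝ) :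
    pathExp ν κ (t + 1) (fun x => F x * g (x (t + 1))) =
      pathExp ν κ t (fun x => F x * ∑ c, κ t x c * g c) := by
  rw [pathExp, ← (Fin.snocEquiv fun _ : Fin (t + 2) => C).sum_comp, Fintype.sum_prod_type,
    Finset.sum_comm, pathExp]
  refine Finset.sum_congr rfl fun y _ => ?_
  rw [← mul_assoc, Finset.mul_sum]
  refine Finset.sum_congr rfl fun c _ => ?_
  have hle : ∀ τ ≤ t, extend (Fin.snoc y c : Fin (t + 2) → C) τ = extend y τ :=
    fun τ hτ => extend_snoc_of_le y c hτ
  change pathWeight ν κ (extend (Fin.snoc y c : Fin (t + 2) → C)) (t + 1) *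
    (F (extend (Fin.snoc y c : Fin (t + 2) → C)) *
      g (extend (Fin.snoc y c : Fin (t + 2) → C) (t + 1))) = _
  rw [pathWeight, hκ.pathWeight_congr hle, hκ.adapted t _ _ hle, hF _ _ hle,
    extend_snoc_last]
  ring

theorem IsProcess.pathExp_succ (hκ : IsProcess ν κ) {t : ℕ} {F : (ℕ → C) → ℝ}
    (hF : Adapted t F) : pathExp ν κ (t + 1) F = pathExp ν κ t F := by
  have := hκ.pathExp_succ_mul hF fun _ => 1
  simpa [(hκ.mem _ _).2] using this

theorem IsProcess.pathExp_of_le (hκ : IsProcess ν κ) {t T : ℕ} (h : t ≤ T) {F : (ℕ → C) → ℝ}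
    (hF : Adapted t F) : pathExp ν κ T F = pathExp ν κ t F := by
  induction T, h using Nat.le_induction with
  | base => rfl
  | succ T hT ih =>
    rw [← ih]
    exact hκ.pathExp_succ fun x x' h => hF x x' fun τ hτ => h τ (hτ.trans hT)

theorem IsProcess.pathExp_const (hκ : IsProcess ν κ) (t : ℕ) (b : ℝ) :
    pathExp ν κ t (fun _ => b) = b := by
  rw [hκ.pathExp_of_le (Nat.zero_le t) fun _ _ _ => rfl, pathExp]
  rw [← (Equiv.funUnique (Fin 1) C).symm.sum_comp]
  simp only [pathWeight, ← Finset.sum_mul]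
  change (∑ c, ν c) * b = b
  rw [hκ.init_mem.2, one_mul]

variable {Z : Type*} [Fintype Z]

theorem abs_sum_mul_le {q : Z → ℝ} (hq : q ∈ stdSimplex ℝ Z) (f : Z → ℝ) :
    |∑ z, q z * f z| ≤ ∑ z, |f z| := by
  refine (Finset.abs_sum_le_sum_abs _ _).trans (Finset.sum_le_sum fun z _ => ?_)
  rw [abs_mul]
  exact mul_le_of_le_one_left (abs_nonneg _) (NormalForm.abs_le_one_of_mem_stdSimplex hq z)

/-- Partial sums of martingale differences grow at most like a square root. -/
theorem IsProcess.pathExp_abs_martingale_le (hκ : IsProcess ν κ) {φ : C → Z}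
    {K : ℕ → (ℕ → C) → Z → ℝ} (hK : ∀ t x, K t x ∈ stdSimplex ℝ Z) (hKa : ∀ t, Adapted t (K t))
    (hκK : ∀ t x (f : Z → ℝ), ∑ c, κ t x c * f (φ c) = ∑ z, K t x z * f z) (f : Z → ℝ) (T : ℕ)
    (hT : 0 < T) :
    pathExp ν κ T (fun x => |∑ t ∈ Finset.range T, (f (φ (x (t + 1))) - ∑ z, K t x z * f z)|) ≤
      (1 + (2 * ∑ z, |f z|) ^ 2) * √T := by
  set M := ∑ z, |f z| with hM
  have hf : ∀ z, |f z| ≤ M := fun z =>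
    Finset.single_le_sum (f := fun z => |f z|) (fun _ _ => abs_nonneg _) (Finset.mem_univ z)
  set S : ℕ → (ℕ → C) → ℝ := fun T x =>
    ∑ t ∈ Finset.range T, (f (φ (x (t + 1))) - ∑ z, K t x z * f z) with hS
  have hSa : ∀ T, Adapted T (S T) := by
    intro T x x' h
    refine Finset.sum_congr rfl fun t ht => ?_
    have ht := Finset.mem_range.1 ht
    rw [h (t + 1) (by omega), hKa t x x' fun τ hτ => h τ (by omega)]
  -- Each increment is at most `2 * M` in absolute value, and its product with the past has mean
  -- zero.
  have hsq : ∀ T, pathExp ν κ T (fun x => S T x ^ 2) ≤ T * (2 * M) ^ 2 := by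
    intro T
    induction T with
    | zero => simp [hS, pathExp]
    | succ T ih =>
      have h0 : Adapted T fun x => S T x * ∑ z, K T x z * f z := fun x x' h => by
        simp only [hSa T x x' h, hKa T x x' h]
      have h1 := hκ.pathExp_succ_mul (hSa T) fun c => f (φ c)
      simp only [hκK] at h1
      have h2 := hκ.pathExp_succ h0
      have h3 : ∀ x, S (T + 1) x ^ 2 ≤ S T x ^ 2 +
          2 * (S T x * f (φ (x (T + 1))) - S T x * ∑ z, K T x z * f z) + (2 * M) ^ 2 := by
        intro x
        have h4 : S (T + 1) x = S T x + (f (φ (x (T + 1))) - ∑ z, K T x z * f z) :=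
          Finset.sum_range_succ _ _
        have h5 : |f (φ (x (T + 1))) - ∑ z, K T x z * f z| ≤ 2 * M := by
          refine (abs_sub _ _).trans ?_
          linarith [hf (φ (x (T + 1))), abs_sum_mul_le (hK T x) f]
        have h6 := sq_le_sq' (abs_le.1 h5).1 (abs_le.1 h5).2
        rw [h4]
        linarith
      refine (hκ.pathExp_mono _ h3).trans ?_
      rw [pathExp_add, pathExp_add, pathExp_const_mul, pathExp_sub, h1, h2, hκ.pathExp_const,
        hκ.pathExp_succ fun x x' h => by simp only [hSa T x x' h]]
      push_cast
      linarith
  have hT' : 0 < √(T : ℝ) := Real.sqrt_pos.2 (by exact_mod_cast hT)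
  -- A pointwise bound that replaces the Cauchy–Schwarz inequality.
  have h1 : ∀ x, |S T x| ≤ √T + (√T)⁻¹ * S T x ^ 2 := by
    intro x
    have h2 : √T * |S T x| ≤ √T * (√T + (√T)⁻¹ * S T x ^ 2) := by
      rw [mul_add, mul_inv_cancel_left₀ hT'.ne', ← sq_abs (S T x)]
      nlinarith [sq_nonneg (√T - |S T x|), abs_nonneg (S T x)]
    exact le_of_mul_le_mul_left h2 hT'
  refine (hκ.pathExp_mono T h1).trans ?_
  rw [pathExp_add, hκ.pathExp_const, pathExp_const_mul]
  have h3 := mul_le_mul_of_nonneg_left (hsq T) (inv_nonneg.2 hT'.le)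
  have h4 : (√T)⁻¹ * (T * (2 * M) ^ 2) = (2 * M) ^ 2 * √T := by
    have : (T : ℝ) = √T * √T := (Real.mul_self_sqrt (Nat.cast_nonneg T)).symm
    nth_rewrite 2 [this]
    field_simp
  linarith

/-! ### Processes whose transition law approaches that of an ergodic chain -/

section Convergence

variable {φ : C → Z} {K : ℕ → (ℕ → C) → Z → ℝ} {K' : Z → Z → ℝ} {p : Z → ℝ}
  {D : ℕ → (ℕ → C) → ℝ}

theorem abs_sum_sub_step_le (hD : ∀ t x z, |K t x z - K' (φ (x t)) z| ≤ D t x) (f : Z → ℝ) (t : ℕ)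
    (x : ℕ → C) :
    |∑ z, K t x z * f z - FiniteChain.step K' f (φ (x t))| ≤ (∑ z, |f z|) * D t x := by
  rw [FiniteChain.step, ← Finset.sum_sub_distrib, Finset.sum_mul]
  refine (Finset.abs_sum_le_sum_abs _ _).trans (Finset.sum_le_sum fun z _ => ?_)
  rw [← sub_mul, abs_mul, mul_comm]
  exact mul_le_mul_of_nonneg_left (hD t x z) (abs_nonneg _)

/-- If the transition law of an observable approaches that of an ergodic chain, its distribution
converges to the stationary distribution. -/
theorem IsProcess.tendsto_pathExp (hκ : IsProcess ν κ)
    (hκK : ∀ t x (f : Z → ℝ), ∑ c, κ t x c * f (φ c) = ∑ z, K t x z * f z)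
    (hD : ∀ t x z, |K t x z - K' (φ (x t)) z| ≤ D t x)
    (hD0 : Tendsto (fun t => pathExp ν κ t (D t)) atTop (𝓝 0))
    (hK' : ∀ z, K' z ∈ stdSimplex ℝ Z) (hK2 : ∀ z z', 0 < ∑ w, K' z w * K' w z')
    (hp : FiniteChain.IsStationary K' p) (f : Z → ℝ) :
    Tendsto (fun t => pathExp ν κ t fun x => f (φ (x t))) atTop (𝓝 (∑ z, p z * f z)) := by
  have h := hp.tendsto_error hK' hK2
    (fun t f => |pathExp ν κ t (fun x => f (φ (x t))) - ∑ z, p z * f z|) 1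
    (fun _ _ => abs_nonneg _) ?_ ?_ f
  · rw [tendsto_iff_dist_tendsto_zero]
    simpa only [Real.dist_eq] using h
  · intro t f δ hδ
    rw [← hκ.pathExp_const t (∑ z, p z * f z), ← pathExp_sub]
    refine (hκ.abs_pathExp_le _ _).trans ?_
    rw [← hκ.pathExp_const t δ]
    exact hκ.pathExp_mono _ fun x => hδ _
  · intro f
    refine ⟨fun t => (∑ z, |f z|) * pathExp ν κ t (D t), by simpa using hD0.const_mul _,
      fun t => ?_⟩
    have h1 := hκ.pathExp_succ_mul (t := t) (F := fun _ => 1) (fun _ _ _ => rfl) fun c => f (φ c)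
    simp only [one_mul, hκK] at h1
    beta_reduce
    rw [h1, hp.sum_step, ← pathExp_const_mul]
    have h2 := (hκ.abs_pathExp_le t
      (fun x => ∑ z, K t x z * f z - FiniteChain.step K' f (φ (x t)))).trans
      (hκ.pathExp_mono t (abs_sum_sub_step_le hD f t))
    rw [pathExp_sub] at h2
    have h3 := abs_sub_le (pathExp ν κ t fun x => ∑ z, K t x z * f z)
      (pathExp ν κ t fun x => FiniteChain.step K' f (φ (x t))) (∑ z, p z * f z)
    linarith

/-- If the transition law of an observable approaches that of an ergodic chain, its time averages
converge in mean to the stationary averages. -/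
theorem IsProcess.tendsto_pathExp_average (hκ : IsProcess ν κ)
    (hK : ∀ t x, K t x ∈ stdSimplex ℝ Z) (hKa : ∀ t, Adapted t (K t))
    (hκK : ∀ t x (f : Z → ℝ), ∑ c, κ t x c * f (φ c) = ∑ z, K t x z * f z)
    (hD : ∀ t x z, |K t x z - K' (φ (x t)) z| ≤ D t x) (hDa : ∀ t, Adapted t (D t))
    (hD0 : Tendsto (fun t => pathExp ν κ t (D t)) atTop (𝓝 0))
    (hK' : ∀ z, K' z ∈ stdSimplex ℝ Z) (hK2 : ∀ z z', 0 < ∑ w, K' z w * K' w z')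
    (hp : FiniteChain.IsStationary K' p) (f : Z → ℝ) :
    Tendsto (fun T : ℕ => pathExp ν κ T fun x =>
      |(T : ℝ)⁻¹ * ∑ t ∈ Finset.range T, f (φ (x t)) - ∑ z, p z * f z|) atTop (𝓝 0) := by
  -- Starting at `1` excludes the empty average, for which the bound required by `tendsto_error`
  -- would fail.
  rw [← tendsto_add_atTop_iff_nat 1]
  refine hp.tendsto_error hK' hK2
    (fun T f => pathExp ν κ (T + 1) fun x =>
      |((T + 1 : ℕ) : ℝ)⁻¹ * ∑ t ∈ Finset.range (T + 1), f (φ (x t)) - ∑ z, p z * f z|) 0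
    (fun _ _ => hκ.pathExp_nonneg _ fun _ => abs_nonneg _) ?_ ?_ f
  · intro T f δ hδ
    rw [← hκ.pathExp_const (T + 1) δ]
    refine hκ.pathExp_mono _ fun x => ?_
    have hT : (0 : ℝ) < ((T + 1 : ℕ) : ℝ) := by positivity
    have h1 : ((T + 1 : ℕ) : ℝ)⁻¹ * ∑ t ∈ Finset.range (T + 1), f (φ (x t)) - ∑ z, p z * f z =
        ((T + 1 : ℕ) : ℝ)⁻¹ * ∑ t ∈ Finset.range (T + 1), (f (φ (x t)) - ∑ z, p z * f z) := by
      rw [Finset.sum_sub_distrib, Finset.sum_const, Finset.card_range, nsmul_eq_mul]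
      field_simp
    rw [h1, abs_mul, abs_of_pos (inv_pos.2 hT), inv_mul_le_iff₀ hT]
    refine (Finset.abs_sum_le_sum_abs _ _).trans ?_
    refine (Finset.sum_le_card_nsmul _ _ δ fun t _ => hδ _).trans_eq ?_
    simp
  · intro f
    set M := ∑ z, |f z| with hM
    have hf : ∀ z, |f z| ≤ M := fun z =>
      Finset.single_le_sum (f := fun z => |f z|) (fun _ _ => abs_nonneg _) (Finset.mem_univ z)
    -- The cost of replacing `f` by `step K' f` in the average: the boundary terms of a shift by
    -- one, the martingale part, and the mean distance between the actual and the limit kernel.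
    let η : ℕ → ℝ := fun T => (T : ℝ)⁻¹ * (2 * M) + (1 + (2 * M) ^ 2) * (√(T : ℝ))⁻¹ +
      M * ((T : ℝ)⁻¹ * ∑ t ∈ Finset.range T, pathExp ν κ t (D t))
    have hη : Tendsto η atTop (𝓝 0) := by
      have h1 : Tendsto (fun T : ℕ => (T : ℝ)⁻¹ * (2 * M)) atTop (𝓝 0) := by
        simpa using tendsto_inv_atTop_nhds_zero_nat.mul_const (2 * M)
      have h2 : Tendsto (fun T : ℕ => (1 + (2 * M) ^ 2) * (√(T : ℝ))⁻¹) atTop (𝓝 0) := by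
        have := (tendsto_inv_atTop_zero.comp
          (Real.tendsto_sqrt_atTop.comp tendsto_natCast_atTop_atTop)).const_mul (1 + (2 * M) ^ 2)
        simpa using this
      have h3 := hD0.cesaro.const_mul M
      rw [mul_zero] at h3
      simpa using (h1.add h2).add h3
    refine ⟨fun T => η (T + 1), hη.comp (tendsto_add_atTop_nat 1), fun T => ?_⟩
    beta_reduce
    rw [hp.sum_step, add_zero]
    generalize hN : T + 1 = N
    have hN0 : 0 < N := by omega
    have hNr : (0 : ℝ) < N := by exact_mod_cast hN0
    set S : (ℕ → C) → ℝ := fun x =>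
      ∑ t ∈ Finset.range N, (f (φ (x (t + 1))) - ∑ z, K t x z * f z) with hS
    have hpt : ∀ x, |(N : ℝ)⁻¹ * ∑ t ∈ Finset.range N, f (φ (x t)) - ∑ z, p z * f z| ≤
        |(N : ℝ)⁻¹ * ∑ t ∈ Finset.range N, FiniteChain.step K' f (φ (x t)) - ∑ z, p z * f z| +
        ((N : ℝ)⁻¹ * (2 * M) + ((N : ℝ)⁻¹ * |S x| +
          (N : ℝ)⁻¹ * (M * ∑ t ∈ Finset.range N, D t x))) := by
      intro x
      have h1 : ∑ t ∈ Finset.range N, f (φ (x t)) =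
          ∑ t ∈ Finset.range N, FiniteChain.step K' f (φ (x t)) +
          ((f (φ (x 0)) - f (φ (x N))) + (S x + ∑ t ∈ Finset.range N,
            (∑ z, K t x z * f z - FiniteChain.step K' f (φ (x t))))) := by
        have h2 := Finset.sum_range_sub (fun t => f (φ (x t))) N
        rw [Finset.sum_sub_distrib] at h2
        simp only [hS, Finset.sum_sub_distrib]
        linarith
      have h3 : |f (φ (x 0)) - f (φ (x N))| ≤ 2 * M := by
        refine (abs_sub _ _).trans ?_
        linarith [hf (φ (x 0)), hf (φ (x N))]
      have h4 : |∑ t ∈ Finset.range N,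
          (∑ z, K t x z * f z - FiniteChain.step K' f (φ (x t)))| ≤
          M * ∑ t ∈ Finset.range N, D t x := by
        rw [Finset.mul_sum]
        exact (Finset.abs_sum_le_sum_abs _ _).trans
          (Finset.sum_le_sum fun t _ => abs_sum_sub_step_le hD f t x)
      have h5 : |(f (φ (x 0)) - f (φ (x N))) + (S x + ∑ t ∈ Finset.range N,
            (∑ z, K t x z * f z - FiniteChain.step K' f (φ (x t))))| ≤
          2 * M + (|S x| + M * ∑ t ∈ Finset.range N, D t x) :=
        (abs_add_le _ _).trans (add_le_add h3 ((abs_add_le _ _).trans (add_le_add le_rfl h4)))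
      rw [h1, mul_add, add_sub_right_comm, ← mul_add, ← mul_add]
      refine (abs_add_le _ _).trans (add_le_add le_rfl ?_)
      rw [abs_mul, abs_of_pos (inv_pos.2 hNr)]
      exact mul_le_mul_of_nonneg_left h5 (inv_pos.2 hNr).le
    refine (hκ.pathExp_mono N hpt).trans ?_
    rw [pathExp_add, pathExp_add, pathExp_add, hκ.pathExp_const, pathExp_const_mul,
      pathExp_const_mul, pathExp_const_mul, pathExp_sum]
    have h6 := hκ.pathExp_abs_martingale_le hK hKa hκK f N hN0
    have h7 : ∑ t ∈ Finset.range N, pathExp ν κ N (D t) =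
        ∑ t ∈ Finset.range N, pathExp ν κ t (D t) :=
      Finset.sum_congr rfl fun t ht => hκ.pathExp_of_le (Finset.mem_range.1 ht).le (hDa t)
    have h8 := mul_le_mul_of_nonneg_left h6 (inv_pos.2 hNr).le
    have h9 : (N : ℝ)⁻¹ * ((1 + (2 * M) ^ 2) * √N) = (1 + (2 * M) ^ 2) * (√(N : ℝ))⁻¹ := by
      have hs : 0 < √(N : ℝ) := Real.sqrt_pos.2 hNr
      have : (N : ℝ) = √N * √N := (Real.mul_self_sqrt hNr.le).symm
      nth_rewrite 1 [this]
      field_simp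
    rw [h9] at h8
    rw [h7]
    change _ ≤ _ + ((N : ℝ)⁻¹ * (2 * M) + (1 + (2 * M) ^ 2) * (√(N : ℝ))⁻¹ +
      M * ((N : ℝ)⁻¹ * ∑ t ∈ Finset.range N, pathExp ν κ t (D t)))
    linarith

end Convergence

end FinitePath

/-! ### Bellman equations -/

namespace StochasticGame

variable {n H : ℕ} {S : Type*} [Fintype S] [DecidableEq S] {A : Fin n → Type*}
  [∀ i, Fintype (A i)] [∀ i, DecidableEq (A i)]

/-- The normal-form game at stage `h` and state `s`, when `w i s'` is the continuation value. -/
noncomputable def stageGame (G : StochasticGame H S A) (h : ℕ) (w : Fin n → S → ℝ) (s : S)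
    (i : Fin n) (a : ∀ i, A i) : ℝ :=
  G.r i h s a + ∑ s', G.P h s a s' * w i s'

/-- The value function, continued by `0` after the last stage. -/
noncomputable def valueFrom (G : StochasticGame H S A) (π : ℕ → S → (∀ i, A i) → ℝ) (h : ℕ)
    (i : Fin n) (s : S) : ℝ :=
  if h < H then G.V π i h s else 0

/-- Expected total reward over `k + 1` stages. -/
noncomputable def expectedReturnFor (G : StochasticGame H S A) (π : ℕ → S → (∀ i, A i) → ℝ)
    (i : Fin n) (k h : ℕ) (μ : S × (∀ i, A i) → ℝ) : ℝ :=
  ∑ w : Fin (k + 1) → S × (∀ i, A i),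
    G.trajProb π h μ w * ∑ j : Fin (k + 1), G.r i (h + j) (w j).1 (w j).2

/-- Distribution of the next state and action. -/
noncomputable def nextDist (G : StochasticGame H S A) (π : ℕ → S → (∀ i, A i) → ℝ) (h : ℕ)
    (x y : S × (∀ i, A i)) : ℝ :=
  G.P h x.1 x.2 y.1 * π (h + 1) y.1 y.2

variable (G : StochasticGame H S A) {π : ℕ → S → (∀ i, A i) → ℝ}

/-- Freeing the length from `H - 1 - h`, which occurs in the type of the trajectories, makes case
analysis on it possible. -/
theorem expectedReturn_eq (i : Fin n) {h k : ℕ} (hk : H - 1 - h = k)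
    (μ : S × (∀ i, A i) → ℝ) : G.expectedReturn π i h μ = G.expectedReturnFor π i k h μ := by
  subst hk
  rfl

theorem trajProb_cons (h : ℕ) (μ : S × (∀ i, A i) → ℝ) {k : ℕ} (x : S × (∀ i, A i))
    (w : Fin (k + 1) → S × (∀ i, A i)) :
    G.trajProb π h μ (Fin.cons x w : Fin (k + 2) → S × (∀ i, A i)) =
      μ x * G.trajProb π (h + 1) (G.nextDist π h x) w := by
  rw [trajProb, Fin.prod_univ_succ, trajProb, nextDist, Fin.cons_zero]
  congr 1
  congr 1
  refine Finset.prod_congr rfl fun j _ => ?_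
  rw [← Fin.succ_castSucc, Fin.cons_succ, Fin.cons_succ, Fin.val_succ,
    show h + ((j : ℕ) + 1) = h + 1 + j by ring]

theorem sum_cons {k : ℕ} {X : Type*} [Fintype X] (F : (Fin (k + 2) → X) → ℝ) :
    ∑ w, F w = ∑ x, ∑ w : Fin (k + 1) → X, F (Fin.cons x w : Fin (k + 2) → X) := by
  rw [← (Fin.consEquiv fun _ : Fin (k + 2) => X).sum_comp, Fintype.sum_prod_type]
  rfl

theorem sum_fin_one {X : Type*} [Fintype X] (F : (Fin 1 → X) → ℝ) :
    ∑ w, F w = ∑ x, F fun _ => x :=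
  ((Equiv.funUnique (Fin 1) X).symm.sum_comp F).symm

theorem sum_nextDist (hπ : G.IsPolicy π) {h : ℕ} (hh : h + 1 < H) (x : S × (∀ i, A i)) :
    ∑ y, G.nextDist π h x y = 1 := by
  simp only [Fintype.sum_prod_type, nextDist, ← Finset.mul_sum, (hπ _ hh _).2, mul_one]
  exact (G.P_mem h (by omega) _ _).2

theorem sum_trajProb (hπ : G.IsPolicy π) (k : ℕ) : ∀ (h : ℕ), h + k < H →
    ∀ μ : S × (∀ i, A i) → ℝ,
    ∑ w : Fin (k + 1) → S × (∀ i, A i), G.trajProb π h μ w = ∑ x, μ x := by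
  induction k with
  | zero =>
    intro h _ μ
    rw [sum_fin_one]
    simp [trajProb]
  | succ k ih =>
    intro h hk μ
    rw [sum_cons]
    refine Finset.sum_congr rfl fun x _ => ?_
    simp only [trajProb_cons, ← Finset.mul_sum]
    rw [ih (h + 1) (by omega), G.sum_nextDist hπ (by omega), mul_one]

theorem expectedReturnFor_zero (i : Fin n) (h : ℕ) (μ : S × (∀ i, A i) → ℝ) :
    G.expectedReturnFor π i 0 h μ = ∑ x, μ x * G.r i h x.1 x.2 := by
  rw [expectedReturnFor, sum_fin_one]
  simp [trajProb]

/-- Split off the first state and action; the probabilities of the remaining trajectories sum to one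
in front of the first reward. -/
theorem expectedReturnFor_succ (hπ : G.IsPolicy π) (i : Fin n) {k h : ℕ} (hk : h + (k + 1) < H)
    (μ : S × (∀ i, A i) → ℝ) :
    G.expectedReturnFor π i (k + 1) h μ =
      ∑ x, μ x * (G.r i h x.1 x.2 + G.expectedReturnFor π i k (h + 1) (G.nextDist π h x)) := by
  rw [expectedReturnFor, sum_cons]
  refine Finset.sum_congr rfl fun x _ => ?_
  have h1 : ∀ w : Fin (k + 1) → S × (∀ i, A i),
      G.trajProb π h μ (Fin.cons x w : Fin (k + 2) → S × (∀ i, A i)) *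
        ∑ j : Fin (k + 2), G.r i (h + j)
          ((Fin.cons x w : Fin (k + 2) → S × (∀ i, A i)) j).1
          ((Fin.cons x w : Fin (k + 2) → S × (∀ i, A i)) j).2 =
      μ x * (G.r i h x.1 x.2 * G.trajProb π (h + 1) (G.nextDist π h x) w +
        G.trajProb π (h + 1) (G.nextDist π h x) w *
          ∑ j : Fin (k + 1), G.r i (h + 1 + j) (w j).1 (w j).2) := by
    intro w
    rw [trajProb_cons, Fin.sum_univ_succ, Fin.cons_zero]
    simp only [Fin.cons_succ, Fin.val_succ, Fin.val_zero, add_zero]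
    have h2 : ∀ j : Fin (k + 1), h + ((j : ℕ) + 1) = h + 1 + j := fun j => by ring
    simp only [h2]
    ring
  simp only [h1, ← Finset.mul_sum, Finset.sum_add_distrib]
  rw [G.sum_trajProb hπ k (h + 1) (by omega), G.sum_nextDist hπ (by omega), mul_one]
  rfl

/-- The expected return is linear in the initial distribution. -/
theorem expectedReturn_eq_sum (hπ : G.IsPolicy π) (i : Fin n) {h : ℕ} (hh : h < H)
    (μ : S × (∀ i, A i) → ℝ) :
    G.expectedReturn π i h μ = ∑ x, μ x * G.Q π i h x.1 x.2 := by
  obtain ⟨k, hk⟩ : ∃ k, H - 1 - h = k := ⟨_, rfl⟩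
  simp only [Q, G.expectedReturn_eq i hk]
  cases k with
  | zero => simp [expectedReturnFor_zero]
  | succ k =>
    have h1 : h + (k + 1) < H := by omega
    simp [G.expectedReturnFor_succ hπ i h1]

theorem V_eq_sum (hπ : G.IsPolicy π) (i : Fin n) {h : ℕ} (hh : h < H) (s : S) :
    G.V π i h s = ∑ a, π h s a * G.Q π i h s a := by
  rw [V, G.expectedReturn_eq_sum hπ i hh, Fintype.sum_prod_type]
  simp [ite_mul, Finset.sum_ite_irrel]

theorem Q_eq_stageGame (hπ : G.IsPolicy π) (i : Fin n) {h : ℕ} (hh : h < H) (s : S)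
    (a : ∀ i, A i) : G.Q π i h s a = G.stageGame h (G.valueFrom π (h + 1)) s i a := by
  obtain ⟨k, hk⟩ : ∃ k, H - 1 - h = k := ⟨_, rfl⟩
  rw [stageGame, Q, G.expectedReturn_eq i hk]
  cases k with
  | zero =>
    have h1 : ¬ h + 1 < H := by omega
    simp [expectedReturnFor_zero, valueFrom, h1]
  | succ k =>
    have h1 : h + (k + 1) < H := by omega
    have h2 : h + 1 < H := by omega
    rw [G.expectedReturnFor_succ hπ i h1]
    simp only [ite_mul, one_mul, zero_mul, Finset.sum_ite_eq', Finset.mem_univ, if_true]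
    rw [← G.expectedReturn_eq i (show H - 1 - (h + 1) = k by omega),
      G.expectedReturn_eq_sum hπ i h2, Fintype.sum_prod_type]
    congr 1
    refine Finset.sum_congr rfl fun s' _ => ?_
    rw [valueFrom, if_pos h2, G.V_eq_sum hπ i h2, Finset.mul_sum]
    exact Finset.sum_congr rfl fun a' _ => mul_assoc _ _ _

theorem valueFrom_eq (hπ : G.IsPolicy π) {h : ℕ} (hh : h < H) (i : Fin n) (s : S) :
    G.valueFrom π h i s = ∑ a, π h s a * G.stageGame h (G.valueFrom π (h + 1)) s i a := by
  rw [valueFrom, if_pos hh, G.V_eq_sum hπ i hh]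
  exact Finset.sum_congr rfl fun a _ => by rw [G.Q_eq_stageGame hπ i hh]

theorem valueFrom_of_le {h : ℕ} (hh : H ≤ h) (i : Fin n) (s : S) : G.valueFrom π h i s = 0 :=
  if_neg (by omega)

theorem stageGame_mono {h : ℕ} (hh : h < H) {w w' : Fin n → S → ℝ} {i : Fin n}
    (hw : ∀ s, w i s ≤ w' i s) (s : S) (a : ∀ i, A i) :
    G.stageGame h w s i a ≤ G.stageGame h w' s i a :=
  add_le_add le_rfl (Finset.sum_le_sum fun s' _ =>
    mul_le_mul_of_nonneg_left (hw s') ((G.P_mem h hh s a).1 s'))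

theorem stageGame_nonneg {h : ℕ} (hh : h < H) {w : Fin n → S → ℝ} {i : Fin n}
    (hw : ∀ s, 0 ≤ w i s) (s : S) (a : ∀ i, A i) : 0 ≤ G.stageGame h w s i a :=
  add_nonneg (G.r_mem i h hh s a).1 (Finset.sum_nonneg fun s' _ =>
    mul_nonneg ((G.P_mem h hh s a).1 s') (hw s'))

theorem abs_stageGame_sub_le {h : ℕ} (hh : h < H) (w w' : Fin n → S → ℝ) (i : Fin n) (s : S)
    (a : ∀ i, A i) :
    |G.stageGame h w s i a - G.stageGame h w' s i a| ≤ ∑ s', |w i s' - w' i s'| := by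
  rw [stageGame, stageGame, add_sub_add_left_eq_sub, ← Finset.sum_sub_distrib]
  simp only [← mul_sub]
  exact FinitePath.abs_sum_mul_le (G.P_mem h hh s a) _

/-- Backward induction over the stages of a game. -/
theorem backward_induction {H : ℕ} {p : ℕ → Prop} (base : ∀ h, H ≤ h → p h)
    (step : ∀ h, h < H → p (h + 1) → p h) (h : ℕ) : p h := by
  by_cases hh : H ≤ h
  · exact base h hh
  · exact Nat.decreasingInduction' (m := h) (n := H) (P := p) (fun k hk _ hp => step k hk hp)
      (by omega) (base H le_rfl)

/-- The optimal value of agent `i`, when all agents cooperate with `i`. -/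
noncomputable def optimalValue (h : ℕ) (i : Fin n) (s : S) : ℝ :=
  if h < H then ⨆ a : ∀ i, A i, G.r i h s a + ∑ s', G.P h s a s' * optimalValue (h + 1) i s' else 0
termination_by H - h

theorem optimalValue_of_lt {h : ℕ} (hh : h < H) (i : Fin n) (s : S) :
    G.optimalValue h i s = ⨆ a : ∀ i, A i, G.stageGame h (G.optimalValue (h + 1)) s i a := by
  rw [optimalValue, if_pos hh]
  rfl

theorem stageGame_le_optimalValue {h : ℕ} (hh : h < H) (i : Fin n) (s : S) (a : ∀ i, A i) :
    G.stageGame h (G.optimalValue (h + 1)) s i a ≤ G.optimalValue h i s := by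
  rw [G.optimalValue_of_lt hh]
  exact le_ciSup (f := fun a => G.stageGame h (G.optimalValue (h + 1)) s i a)
    (Set.finite_range _).bddAbove a

theorem optimalValue_nonneg [∀ i, Nonempty (A i)] (h : ℕ) :
    ∀ i s, 0 ≤ G.optimalValue h i s := by
  refine backward_induction (H := H) (p := fun h => ∀ i s, 0 ≤ G.optimalValue h i s) ?_ ?_ h
  · intro h hh i s
    rw [optimalValue, if_neg (by omega)]
  · intro h hh ih i s
    exact (G.stageGame_nonneg hh (ih i) s (Classical.arbitrary _)).trans
      (G.stageGame_le_optimalValue hh i s _)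

/-- The deterministic policy that is greedy for agent `i` attains the optimal value, so the left
side is one of its Q-values and the normalization applies. By monotonicity the bound extends to all
smaller continuation values, including the critic's, which need not come from a policy. -/
theorem stageGame_optimalValue_lt_one [∀ i, Nonempty (A i)]
    (hQ : ∀ π, G.IsPolicy π → ∀ i h, h < H → ∀ s a, G.Q π i h s a < 1)
    {h : ℕ} (hh : h < H) (i : Fin n) (s : S) (a : ∀ i, A i) :
    G.stageGame h (G.optimalValue (h + 1)) s i a < 1 := by
  choose b hb using fun (h : ℕ) (s : S) =>
    Finite.exists_max fun a => G.stageGame h (G.optimalValue (h + 1)) s i a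
  set π : ℕ → S → (∀ i, A i) → ℝ := fun h s => Pi.single (b h s) 1 with hπdef
  have hπ : G.IsPolicy π := fun h _ s => single_mem_stdSimplex ℝ _
  have hV : ∀ h, ∀ s, G.optimalValue h i s = G.valueFrom π h i s := by
    refine backward_induction (H := H) (fun h hh s => ?_) fun h hh ih s => ?_
    · rw [optimalValue, if_neg (by omega), G.valueFrom_of_le hh]
    · rw [G.valueFrom_eq hπ hh]
      have h1 : ∑ a, π h s a * G.stageGame h (G.valueFrom π (h + 1)) s i a =
          G.stageGame h (G.valueFrom π (h + 1)) s i (b h s) := by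
        simp [hπdef, Pi.single_apply]
      have h2 : ∀ a, G.stageGame h (G.valueFrom π (h + 1)) s i a =
          G.stageGame h (G.optimalValue (h + 1)) s i a := fun a => by
        simp only [stageGame, ih]
      rw [h1, h2]
      refine le_antisymm ?_ (G.stageGame_le_optimalValue hh i s _)
      rw [G.optimalValue_of_lt hh]
      exact ciSup_le (hb h s)
  have h1 := hQ π hπ i h hh s a
  rw [G.Q_eq_stageGame hπ i hh] at h1
  refine lt_of_eq_of_lt ?_ h1
  simp only [stageGame, hV]

end StochasticGame

/-! ### A choice of stationary distribution -/

namespace NormalForm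

variable {n : ℕ} {A : Fin n → Type*} [∀ i, Fintype (A i)] [∀ i, DecidableEq (A i)]

open Classical in
/-- The stationary distribution of the mood-based learning rule. -/
noncomputable def stationaryDist (c ε : ℝ) (u : Fin n → (∀ i, A i) → ℝ) :
    (∀ i, A i) × (Fin n → Mood) → ℝ :=
  -- Any choice will do: the convergence theorems hold for every stationary distribution of a chain
  -- with positive two-step probabilities.
  if h : ∃ p, FiniteChain.IsStationary (moodKernel c ε u) p then h.choose else 0

theorem isStationary_stationaryDist [∀ i, Nontrivial (A i)] {c ε : ℝ} (hc : 0 ≤ c)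
    (hε : ε ∈ Set.Ioo (0 : ℝ) 1) {u : Fin n → (∀ i, A i) → ℝ} (hu : ∀ i a, u i a ≤ 1) :
    FiniteChain.IsStationary (moodKernel c ε u) (stationaryDist c ε u) := by
  have : Nonempty ((∀ i, A i) × (Fin n → Mood)) :=
    ⟨(fun i => Classical.arbitrary _, fun _ => Mood.content)⟩
  have h := FiniteChain.exists_isStationary (moodKernel_mem_stdSimplex hc hε hu)
  rw [stationaryDist, dif_pos h]
  exact h.choose_spec

end NormalForm

/-! ### Convergence of the algorithm -/

/-- The marginal of a product distribution. It is applied twice, to the stages and to the states, to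
isolate one component of a configuration. -/
theorem sum_prod_mul_apply {ι Z : Type*} [Fintype ι] [DecidableEq ι] [Fintype Z] {q : ι → Z → ℝ}
    (hq : ∀ i, q i ∈ stdSimplex ℝ Z) (i₀ : ι) (f : Z → ℝ) :
    ∑ b : ι → Z, (∏ i, q i (b i)) * f (b i₀) = ∑ z, q i₀ z * f z := by
  have h1 : ∀ b : ι → Z, (∏ i, q i (b i)) * f (b i₀) =
      ∏ i, q i (b i) * (if i = i₀ then f (b i) else 1) := by
    intro b
    rw [Finset.prod_mul_distrib, Finset.prod_ite_eq' Finset.univ i₀ (fun i => f (b i)),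
      if_pos (Finset.mem_univ _)]
  have h2 := Finset.prod_univ_sum (fun _ : ι => (Finset.univ : Finset Z))
    fun i z => q i z * (if i = i₀ then f z else 1)
  rw [Fintype.piFinset_univ] at h2
  simp only [h1]
  rw [← h2, ← Finset.mul_prod_erase _ _ (Finset.mem_univ i₀), Finset.prod_eq_one, mul_one]
  · simp
  · intro i hi
    simp [Finset.ne_of_mem_erase hi, (hq i).2]

namespace StochasticGame

variable {n H : ℕ} {S : Type*} [Fintype S] [DecidableEq S] {A : Fin n → Type*}
  [∀ i, Fintype (A i)] [∀ i, DecidableEq (A i)] (G : StochasticGame H S A)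

/-- The limit of the critic's value estimates for a given rate of mistakes. -/
noncomputable def limitValue (c ε : ℝ) (h : ℕ) (i : Fin n) (s : S) : ℝ :=
  if h < H then
    ∑ z, NormalForm.stationaryDist c ε
        (fun i a => G.r i h s a + ∑ s', G.P h s a s' * limitValue c ε (h + 1) i s') z *
      (G.r i h s z.1 + ∑ s', G.P h s z.1 s' * limitValue c ε (h + 1) i s')
  else 0
termination_by H - h

/-- The limit distribution of the actions and moods for a given rate of mistakes. -/
noncomputable def limitDist (c ε : ℝ) (h : ℕ) (s : S) : (∀ i, A i) × (Fin n → Mood) → ℝ :=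
  NormalForm.stationaryDist c ε (G.stageGame h (G.limitValue c ε (h + 1)) s)

theorem limitValue_of_lt (c ε : ℝ) {h : ℕ} (hh : h < H) (i : Fin n) (s : S) :
    G.limitValue c ε h i s =
      ∑ z, G.limitDist c ε h s z * G.stageGame h (G.limitValue c ε (h + 1)) s i z.1 := by
  rw [limitValue, if_pos hh]
  rfl

theorem limitValue_of_le (c ε : ℝ) {h : ℕ} (hh : H ≤ h) (i : Fin n) (s : S) :
    G.limitValue c ε h i s = 0 := by
  rw [limitValue, if_neg (by omega)]

/-- The critic's continuation values. -/
noncomputable def criticCont (x : ℕ → G.Config) (t h : ℕ) (i : Fin n) (s : S) : ℝ :=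
  G.criticV x t i h s

theorem criticCont_of_le (x : ℕ → G.Config) (t : ℕ) {h : ℕ} (hh : H ≤ h) (i : Fin n) (s : S) :
    G.criticCont x t h i s = 0 := by
  cases t with
  | zero => rfl
  | succ t => exact dif_neg (by omega)

theorem criticCont_succ (x : ℕ → G.Config) (t : ℕ) {h : ℕ} (hh : h < H) (i : Fin n) (s : S) :
    G.criticCont x (t + 1) h i s = (t : ℝ) / (t + 1) * G.criticCont x t h i s +
      1 / ((t : ℝ) + 1) * G.stageGame h (G.criticCont x t (h + 1)) s i (x t ⟨h, hh⟩ s).1 :=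
  dif_pos hh

/-- The step sizes `1 / (t + 1)` give all past payoffs equal weight, which is what lets an ergodic
theorem govern the critic. -/
theorem criticCont_eq_average (x : ℕ → G.Config) (T : ℕ) {h : ℕ} (hh : h < H) (i : Fin n) (s : S) :
    G.criticCont x T h i s = (T : ℝ)⁻¹ * ∑ t ∈ Finset.range T,
      G.stageGame h (G.criticCont x t (h + 1)) s i (x t ⟨h, hh⟩ s).1 := by
  induction T with
  | zero => simp [criticCont, criticV]
  | succ T ih =>
    rw [G.criticCont_succ x T hh, Finset.sum_range_succ, ih]
    rcases Nat.eq_zero_or_pos T with rfl | hT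
    · simp
    · have : (0 : ℝ) < T := by exact_mod_cast hT
      push_cast
      field_simp

theorem criticV_congr {t : ℕ} {x x' : ℕ → G.Config} (h : ∀ τ < t, x τ = x' τ) :
    G.criticV x t = G.criticV x' t := by
  induction t with
  | zero => rfl
  | succ t ih =>
    simp only [criticV]
    rw [ih fun τ hτ => h τ (by omega), h t (by omega)]

theorem criticCont_congr {t : ℕ} {x x' : ℕ → G.Config} (h : ∀ τ ≤ t, x τ = x' τ) :
    G.criticCont x t = G.criticCont x' t := by
  ext h' i s
  rw [criticCont, criticCont, G.criticV_congr fun τ hτ => h τ hτ.le]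

/-- Each update is a convex combination of values within the bounds. This holds along every path, so
the learning rule always receives payoffs below `1` and remains a stochastic kernel. -/
theorem criticCont_mem [∀ i, Nonempty (A i)] (x : ℕ → G.Config) (t : ℕ) :
    ∀ h i s, 0 ≤ G.criticCont x t h i s ∧ G.criticCont x t h i s ≤ G.optimalValue h i s := by
  induction t with
  | zero => exact fun h i s => ⟨le_rfl, G.optimalValue_nonneg h i s⟩
  | succ t ih =>
    intro h i s
    by_cases hh : h < H
    · rw [G.criticCont_succ x t hh]
      have h1 := G.stageGame_nonneg hh (fun s => (ih (h + 1) i s).1) s (x t ⟨h, hh⟩ s).1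
      have h2 := (G.stageGame_mono hh (fun s => (ih (h + 1) i s).2) s (x t ⟨h, hh⟩ s).1).trans
        (G.stageGame_le_optimalValue hh i s _)
      have h3 := ih h i s
      have h4 : (0 : ℝ) ≤ (t : ℝ) / (t + 1) := by positivity
      have h5 : (0 : ℝ) ≤ 1 / ((t : ℝ) + 1) := by positivity
      refine ⟨add_nonneg (mul_nonneg h4 h3.1) (mul_nonneg h5 h1), ?_⟩
      refine (add_le_add (mul_le_mul_of_nonneg_left h3.2 h4)
        (mul_le_mul_of_nonneg_left h2 h5)).trans_eq ?_
      field_simp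
    · rw [G.criticCont_of_le x _ (not_lt.1 hh)]
      exact ⟨le_rfl, G.optimalValue_nonneg h i s⟩

section Algorithm

variable [∀ i, Nontrivial (A i)]
  (hU : ∀ h, h < H → ∀ i s a, G.stageGame h (G.optimalValue (h + 1)) s i a < 1)

include hU

theorem stageGame_lt_one {h : ℕ} (hh : h < H) {w : Fin n → S → ℝ}
    (hw : ∀ i s, w i s ≤ G.optimalValue (h + 1) i s) (s : S) (i : Fin n) (a : ∀ i, A i) :
    G.stageGame h w s i a < 1 :=
  (G.stageGame_mono hh (hw i) s a).trans_lt (hU h hh i s a)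

variable {c ε : ℝ} (hc : 0 ≤ c) (hε : ε ∈ Set.Ioo (0 : ℝ) 1)

include hc hε

theorem limitValue_mem (h : ℕ) :
    ∀ i s, 0 ≤ G.limitValue c ε h i s ∧ G.limitValue c ε h i s ≤ G.optimalValue h i s := by
  refine backward_induction (H := H) (p := fun h => ∀ i s, 0 ≤ G.limitValue c ε h i s ∧
    G.limitValue c ε h i s ≤ G.optimalValue h i s) ?_ ?_ h
  · intro h hh i s
    rw [G.limitValue_of_le c ε hh]
    exact ⟨le_rfl, G.optimalValue_nonneg h i s⟩
  · intro h hh ih i s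
    rw [G.limitValue_of_lt c ε hh]
    have hp := (NormalForm.isStationary_stationaryDist hc hε fun i a =>
      (G.stageGame_lt_one hU hh (fun i s => (ih i s).2) s i a).le).1
    refine ⟨Finset.sum_nonneg fun z _ => mul_nonneg (hp.1 z)
      (G.stageGame_nonneg hh (fun s => (ih i s).1) s z.1), ?_⟩
    calc _ ≤ ∑ z, G.limitDist c ε h s z * G.optimalValue h i s :=
          Finset.sum_le_sum fun z _ => mul_le_mul_of_nonneg_left
            ((G.stageGame_mono hh (fun s => (ih i s).2) s z.1).trans
              (G.stageGame_le_optimalValue hh i s _)) (hp.1 z)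
      _ = _ := by rw [← Finset.sum_mul]; exact (congrArg (· * _) hp.2).trans (one_mul _)

theorem isStationary_limitDist {h : ℕ} (hh : h < H) (s : S) :
    FiniteChain.IsStationary
      (NormalForm.moodKernel c ε (G.stageGame h (G.limitValue c ε (h + 1)) s))
      (G.limitDist c ε h s) :=
  NormalForm.isStationary_stationaryDist hc hε fun i a => (G.stageGame_lt_one hU hh
    (fun i s => (G.limitValue_mem hU hc hε (h + 1) i s).2) s i a).le

end Algorithm

/-- The conditional distribution of the next configuration. -/
noncomputable def configKernel (c ε : ℝ) (t : ℕ) (x : ℕ → G.Config) (y : G.Config) : ℝ :=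
  ∏ h : Fin H, ∏ s : S,
    NormalForm.moodKernel c ε (G.stageGame h (G.criticCont x t (h + 1)) s) (x t h s) (y h s)

theorem pathProb_eq_pathWeight (c ε : ℝ) (ν : G.Config → ℝ) (x : ℕ → G.Config) (t : ℕ) :
    G.pathProb c ε ν x t = FinitePath.pathWeight ν (G.configKernel c ε) x t := by
  induction t with
  | zero => rfl
  | succ t ih =>
    rw [pathProb, ih]
    rfl

theorem iterDist_eq_pathExp (c ε : ℝ) (ν : G.Config → ℝ) (t : ℕ) (h : Fin H) (s : S)
    (z : (∀ i, A i) × (Fin n → Mood)) :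
    G.iterDist c ε ν t h s z = FinitePath.pathExp ν (G.configKernel c ε) t
      fun x => if x t h s = z then 1 else 0 := by
  refine Finset.sum_congr rfl fun y _ => ?_
  have h1 : FinitePath.extend y t = y (Fin.last t) := by
    rw [FinitePath.extend]
    congr 1
    ext
    simp
  beta_reduce
  rw [h1, pathProb_eq_pathWeight, mul_ite, mul_one, mul_zero]
  rfl

section Convergence

variable [∀ i, Nontrivial (A i)]
  (hU : ∀ h, h < H → ∀ i s a, G.stageGame h (G.optimalValue (h + 1)) s i a < 1)
  {c ε : ℝ} (hε : ε ∈ Set.Ioo (0 : ℝ) 1)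

include hU hε

theorem moodKernel_critic_mem (hc : 0 ≤ c) (x : ℕ → G.Config) (t : ℕ) {h : ℕ} (hh : h < H) (s : S)
    (z : (∀ i, A i) × (Fin n → Mood)) :
    NormalForm.moodKernel c ε (G.stageGame h (G.criticCont x t (h + 1)) s) z ∈ stdSimplex ℝ _ :=
  NormalForm.moodKernel_mem_stdSimplex hc hε (fun i a => (G.stageGame_lt_one hU hh
    (fun i s => (G.criticCont_mem x t (h + 1) i s).2) s i a).le) z

theorem isProcess_configKernel (hc : 0 ≤ c) {ν : G.Config → ℝ} (hν : ν ∈ stdSimplex ℝ G.Config) :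
    FinitePath.IsProcess ν (G.configKernel c ε) where
  init_mem := hν
  mem t x := pi_prod_mem_stdSimplex fun h => pi_prod_mem_stdSimplex fun s =>
    G.moodKernel_critic_mem hU hε hc x t h.2 s (x t h s)
  adapted t x x' hx := by
    ext y
    simp only [configKernel]
    rw [G.criticCont_congr hx, hx t le_rfl]

theorem sum_configKernel_mul (hc : 0 ≤ c) {h : ℕ} (hh : h < H) (s : S) (t : ℕ) (x : ℕ → G.Config)
    (f : (∀ i, A i) × (Fin n → Mood) → ℝ) :
    ∑ y, G.configKernel c ε t x y * f (y ⟨h, hh⟩ s) =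
      ∑ z, NormalForm.moodKernel c ε (G.stageGame h (G.criticCont x t (h + 1)) s)
        (x t ⟨h, hh⟩ s) z * f z := by
  have hk := fun (h : Fin H) s => G.moodKernel_critic_mem hU hε hc x t h.2 s (x t h s)
  rw [← sum_prod_mul_apply (hk ⟨h, hh⟩) s f,
    ← sum_prod_mul_apply (fun h => pi_prod_mem_stdSimplex (hk h)) ⟨h, hh⟩ fun b => f (b s)]
  rfl

/-- A bound for the error of the payoffs that the critic provides at stage `h`. -/
noncomputable def criticError (c ε : ℝ) (h t : ℕ) (x : ℕ → G.Config) : ℝ :=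
  ∑ i, ∑ s, |G.criticCont x t h i s - G.limitValue c ε h i s|

omit [∀ i, Nontrivial (A i)] hU hε in
theorem criticError_adapted (h t : ℕ) : FinitePath.Adapted t (G.criticError c ε h t) := by
  intro x x' hx
  simp only [criticError]
  rw [G.criticCont_congr hx]

omit [∀ i, Nontrivial (A i)] hU hε in
theorem abs_stageGame_critic_sub_le {h : ℕ} (hh : h < H) (x : ℕ → G.Config) (t : ℕ) (s : S)
    (i : Fin n) (a : ∀ i, A i) :
    |G.stageGame h (G.criticCont x t (h + 1)) s i a -
      G.stageGame h (G.limitValue c ε (h + 1)) s i a| ≤ G.criticError c ε (h + 1) t x :=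
  (G.abs_stageGame_sub_le hh _ _ i s a).trans <|
    Finset.single_le_sum (f := fun i => ∑ s,
      |G.criticCont x t (h + 1) i s - G.limitValue c ε (h + 1) i s|)
      (fun _ _ => Finset.sum_nonneg fun _ _ => abs_nonneg _) (Finset.mem_univ i)

/-- The factor `|Real.log ε|` is harmless, because `ε` is fixed while `t` tends to infinity. -/
theorem abs_moodKernel_critic_sub_le (hc : 0 ≤ c) {h : ℕ} (hh : h < H) (x : ℕ → G.Config) (t : ℕ)
    (s : S) (z z' : (∀ i, A i) × (Fin n → Mood)) :
    |NormalForm.moodKernel c ε (G.stageGame h (G.criticCont x t (h + 1)) s) z z' -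
      NormalForm.moodKernel c ε (G.stageGame h (G.limitValue c ε (h + 1)) s) z z'| ≤
      |Real.log ε| * n * G.criticError c ε (h + 1) t x := by
  refine (NormalForm.abs_moodKernel_sub_le hc hε
    (fun i a => (G.stageGame_lt_one hU hh
      (fun i s => (G.criticCont_mem x t (h + 1) i s).2) s i a).le)
    (fun i a => (G.stageGame_lt_one hU hh
      (fun i s => (G.limitValue_mem hU hc hε (h + 1) i s).2) s i a).le) z z').trans ?_
  rw [mul_assoc]
  refine mul_le_mul_of_nonneg_left ?_ (abs_nonneg _)
  refine (Finset.sum_le_card_nsmul _ _ _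
    fun i _ => G.abs_stageGame_critic_sub_le hh x t s i z'.1).trans_eq ?_
  simp

variable [Nonempty (Fin n)] {ν : G.Config → ℝ}

theorem moodKernel_limit_two_step_pos (hc : 0 < c) {h : ℕ} (hh : h < H) (s : S)
    (z z' : (∀ i, A i) × (Fin n → Mood)) :
    0 < ∑ w, NormalForm.moodKernel c ε (G.stageGame h (G.limitValue c ε (h + 1)) s) z w *
      NormalForm.moodKernel c ε (G.stageGame h (G.limitValue c ε (h + 1)) s) w z' :=
  NormalForm.moodKernel_two_step_pos hc hε (fun i a => G.stageGame_lt_one hU hh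
      (fun i s => (G.limitValue_mem hU hc.le hε (h + 1) i s).2) s i a) z z'

theorem tendsto_iterDist_of_criticError (hc : 0 < c) (hν : ν ∈ stdSimplex ℝ G.Config) (h : Fin H)
    (hE : Tendsto (fun t => FinitePath.pathExp ν (G.configKernel c ε) t
      (G.criticError c ε (h + 1) t)) atTop (𝓝 0)) (s : S) (z : (∀ i, A i) × (Fin n → Mood)) :
    Tendsto (fun t => G.iterDist c ε ν t h s z) atTop (𝓝 (G.limitDist c ε h s z)) := by
  have h1 := (G.isProcess_configKernel hU hε hc.le hν).tendsto_pathExp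
    (G.sum_configKernel_mul hU hε hc.le h.2 s)
    (D := fun t x => |Real.log ε| * n * G.criticError c ε (h + 1) t x)
    (fun t x z => G.abs_moodKernel_critic_sub_le hU hε hc.le h.2 x t s _ z)
    (by simpa [FinitePath.pathExp_const_mul] using hE.const_mul (|Real.log ε| * n))
    (fun z => NormalForm.moodKernel_mem_stdSimplex hc.le hε (fun i a => (G.stageGame_lt_one hU h.2
      (fun i s => (G.limitValue_mem hU hc.le hε (h + 1) i s).2) s i a).le) z)
    (G.moodKernel_limit_two_step_pos hU hε hc h.2 s)
    (G.isStationary_limitDist hU hc.le hε h.2 s) (fun z' => if z' = z then 1 else 0)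
  simp only [mul_ite, mul_one, mul_zero, Finset.sum_ite_eq', Finset.mem_univ, if_true] at h1
  simp only [iterDist_eq_pathExp]
  exact h1

/-- The critic's value estimates converge in mean. -/
theorem tendsto_criticError (hc : 0 < c) (hν : ν ∈ stdSimplex ℝ G.Config) (h : ℕ) :
    Tendsto (fun t => FinitePath.pathExp ν (G.configKernel c ε) t (G.criticError c ε h t))
      atTop (𝓝 0) := by
  have hκ := G.isProcess_configKernel hU hε hc.le hν
  refine backward_induction (H := H) (p := fun h => Tendsto (fun t =>
    FinitePath.pathExp ν (G.configKernel c ε) t (G.criticError c ε h t)) atTop (𝓝 0)) ?_ ?_ h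
  · intro h hh
    have h1 : ∀ t, FinitePath.pathExp ν (G.configKernel c ε) t (G.criticError c ε h t) = 0 := by
      intro t
      rw [show G.criticError c ε h t = fun _ => 0 from ?_, hκ.pathExp_const]
      ext x
      simp [criticError, G.criticCont_of_le x t hh, G.limitValue_of_le c ε hh]
    simp only [h1]
    exact tendsto_const_nhds
  · intro h hh ih
    have hterm : ∀ i s, Tendsto (fun t => FinitePath.pathExp ν (G.configKernel c ε) t fun x =>
        |G.criticCont x t h i s - G.limitValue c ε h i s|) atTop (𝓝 0) := by
      intro i s
      let f : (∀ i, A i) × (Fin n → Mood) → ℝ := fun z =>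
        G.stageGame h (G.limitValue c ε (h + 1)) s i z.1
      have h1 := hκ.tendsto_pathExp_average
        (K := fun t x => NormalForm.moodKernel c ε
          (G.stageGame h (G.criticCont x t (h + 1)) s) (x t ⟨h, hh⟩ s))
        (fun t x => G.moodKernel_critic_mem hU hε hc.le x t hh s _)
        (fun t x x' hx => by
          beta_reduce
          rw [G.criticCont_congr hx, hx t le_rfl])
        (G.sum_configKernel_mul hU hε hc.le hh s)
        (D := fun t x => |Real.log ε| * n * G.criticError c ε (h + 1) t x)
        (fun t x z => G.abs_moodKernel_critic_sub_le hU hε hc.le hh x t s _ z)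
        (fun t x x' hx => by simp only [G.criticError_adapted (h + 1) t x x' hx])
        (by simpa [FinitePath.pathExp_const_mul] using ih.const_mul (|Real.log ε| * n))
        (fun z => NormalForm.moodKernel_mem_stdSimplex hc.le hε (fun i a => (G.stageGame_lt_one
          hU hh (fun i s => (G.limitValue_mem hU hc.le hε (h + 1) i s).2) s i a).le) z)
        (G.moodKernel_limit_two_step_pos hU hε hc hh s)
        (G.isStationary_limitDist hU hc.le hε hh s) f
      -- The error splits in two: the average payoff error due to the continuation values at stage
      -- `h + 1`, and the ergodic fluctuation of the payoffs `f` with limit continuation values.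
      have h2 := ih.cesaro.add h1
      rw [add_zero] at h2
      refine squeeze_zero (fun T => hκ.pathExp_nonneg T fun x => abs_nonneg _) (fun T => ?_) h2
      have h3 : ∑ t ∈ Finset.range T, FinitePath.pathExp ν (G.configKernel c ε) t
          (G.criticError c ε (h + 1) t) = ∑ t ∈ Finset.range T,
          FinitePath.pathExp ν (G.configKernel c ε) T (G.criticError c ε (h + 1) t) :=
        Finset.sum_congr rfl fun t ht =>
          (hκ.pathExp_of_le (Finset.mem_range.1 ht).le (G.criticError_adapted (h + 1) t)).symm
      rw [h3, ← FinitePath.pathExp_sum, ← FinitePath.pathExp_const_mul, ← FinitePath.pathExp_add]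
      refine hκ.pathExp_mono T fun x => ?_
      rw [G.criticCont_eq_average x T hh, G.limitValue_of_lt c ε hh]
      refine (abs_sub_le _ ((T : ℝ)⁻¹ * ∑ t ∈ Finset.range T, f (x t ⟨h, hh⟩ s)) _).trans
        (add_le_add ?_ le_rfl)
      rw [← mul_sub, ← Finset.sum_sub_distrib, abs_mul,
        abs_of_nonneg (inv_nonneg.2 (Nat.cast_nonneg T))]
      refine mul_le_mul_of_nonneg_left ?_ (inv_nonneg.2 (Nat.cast_nonneg T))
      exact (Finset.abs_sum_le_sum_abs _ _).trans (Finset.sum_le_sum fun t _ =>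
        G.abs_stageGame_critic_sub_le hh x t s i _)
    have h4 := tendsto_finsetSum Finset.univ fun i (_ : i ∈ Finset.univ) =>
      tendsto_finsetSum Finset.univ fun s (_ : s ∈ Finset.univ) => hterm i s
    simp only [Finset.sum_const_zero] at h4
    refine h4.congr fun t => ?_
    simp only [← FinitePath.pathExp_sum]
    rfl

end Convergence

end StochasticGame

/-! ### The limit of no mistakes -/

namespace StochasticGame

variable {n H : ℕ} {S : Type*} [Fintype S] [DecidableEq S] {A : Fin n → Type*}
  [∀ i, Fintype (A i)] [∀ i, DecidableEq (A i)] (G : StochasticGame H S A)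

theorem polyTendsto_stageGame {w : ℝ → Fin n → S → ℝ} {W : Fin n → S → ℝ} {i : Fin n}
    (hw : ∀ s, PolyTendsto (fun ε => w ε i s) (W i s)) (h : ℕ) (s : S) (a : ∀ i, A i) :
    PolyTendsto (fun ε => G.stageGame h (w ε) s i a) (G.stageGame h W s i a) :=
  (PolyTendsto.const _).add (PolyTendsto.sum _ fun s' _ => (hw s').const_mul _)

/-- Transitions are common to all agents, so total payoffs depend on the continuation values only
through their sum. -/
theorem sum_stageGame_mono {h : ℕ} (hh : h < H) {w w' : Fin n → S → ℝ}
    (hw : ∀ s, ∑ i, w i s ≤ ∑ i, w' i s) (s : S) (a : ∀ i, A i) :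
    ∑ i, G.stageGame h w s i a ≤ ∑ i, G.stageGame h w' s i a := by
  simp only [stageGame, Finset.sum_add_distrib]
  refine add_le_add le_rfl ?_
  rw [Finset.sum_comm, Finset.sum_comm (f := fun i s' => G.P h s a s' * w' i s')]
  simp only [← Finset.mul_sum]
  exact Finset.sum_le_sum fun s' _ => mul_le_mul_of_nonneg_left (hw s') ((G.P_mem h hh s a).1 s')

section

variable [∀ i, Nontrivial (A i)] [Nonempty (Fin n)] {c : ℝ} (hc : (n : ℝ) ≤ c)
  (hU : ∀ h, h < H → ∀ i s a, G.stageGame h (G.optimalValue (h + 1)) s i a < 1)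

include hc hU

/-- The limit payoffs remain strictly below `1`, as needed for `exists_stationary_limit`, because
the bound by the optimal value passes to the limit. -/
theorem exists_limitDist_limit {h : ℕ} (hh : h < H) {W : Fin n → S → ℝ}
    (hW : ∀ i s, PolyTendsto (fun ε => G.limitValue c ε (h + 1) i s) (W i s)) (s : S) :
    ∃ p : (∀ i, A i) × (Fin n → Mood) → ℝ, p ∈ stdSimplex ℝ _ ∧
      (∀ z, PolyTendsto (fun ε => G.limitDist c ε h s z) (p z)) ∧
      ∀ z, p z ≠ 0 → ∀ b, ∑ i, G.stageGame h W s i b ≤ ∑ i, G.stageGame h W s i z.1 := by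
  have hc0 : 0 ≤ c := (Nat.cast_nonneg n).trans hc
  have hmem : ∀ᶠ ε in 𝓝[>] (0 : ℝ), ε ∈ Set.Ioo (0 : ℝ) 1 := Ioo_mem_nhdsGT zero_lt_one
  have hW0 : ∀ i s, 0 ≤ W i s := fun i s => ge_of_tendsto (hW i s).tendsto
    (hmem.mono fun ε hε => (G.limitValue_mem hU hc0 hε (h + 1) i s).1)
  have hW1 : ∀ i s, W i s ≤ G.optimalValue (h + 1) i s := fun i s =>
    le_of_tendsto (hW i s).tendsto
      (hmem.mono fun ε hε => (G.limitValue_mem hU hc0 hε (h + 1) i s).2)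
  have hst := hmem.mono fun ε hε => G.isStationary_limitDist hU hc0 hε hh s
  obtain ⟨p, hp1, hp2⟩ := NormalForm.exists_stationary_limit hc
    (fun i a => G.polyTendsto_stageGame (hW i) h s a)
    (fun i a => ⟨G.stageGame_nonneg hh (hW0 i) s a, G.stageGame_lt_one hU hh hW1 s i a⟩) hst
  refine ⟨p, ⟨fun z => ge_of_tendsto (hp1 z).tendsto (hst.mono fun ε h => h.1.1 z), ?_⟩, hp1, hp2⟩
  refine tendsto_nhds_unique (PolyTendsto.sum Finset.univ fun z _ => hp1 z).tendsto ?_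
  exact tendsto_const_nhds.congr' (hst.mono fun ε h => h.1.2.symm)

/-- The rate is part of the induction: values at one stage become exponents of `ε` at the preceding
one. -/
theorem exists_limitValue_limit (h : ℕ) :
    ∃ W : Fin n → S → ℝ, ∀ i s, PolyTendsto (fun ε => G.limitValue c ε h i s) (W i s) := by
  refine backward_induction (H := H) (p := fun h => ∃ W : Fin n → S → ℝ, ∀ i s,
    PolyTendsto (fun ε => G.limitValue c ε h i s) (W i s)) ?_ ?_ h
  · intro h hh
    refine ⟨fun _ _ => 0, fun i s => ?_⟩
    simp only [G.limitValue_of_le _ _ hh]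
    exact PolyTendsto.const 0
  · rintro h hh ⟨W, hW⟩
    choose p _ hp _ using G.exists_limitDist_limit hc hU hh hW
    refine ⟨fun i s => ∑ z, p s z * G.stageGame h W s i z.1, fun i s => ?_⟩
    simp only [G.limitValue_of_lt _ _ hh]
    exact PolyTendsto.sum _ fun z _ => (hp s z).mul (G.polyTendsto_stageGame (hW i) h s z.1)

/-- As the rate of mistakes vanishes, the limit distributions converge to a Pareto optimal
policy. -/
theorem exists_limitDist_limit_isParetoOptimal :
    ∃ πstar : ℕ → S → (∀ i, A i) × (Fin n → Mood) → ℝ,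
      (∀ (h : Fin H) s z,
        Tendsto (fun ε => G.limitDist c ε h s z) (𝓝[>] 0) (𝓝 (πstar h s z))) ∧
      G.IsParetoOptimal (fun h s a => ∑ ξ : Fin n → Mood, πstar h s (a, ξ)) := by
  choose W hW using G.exists_limitValue_limit hc hU
  have hex : ∀ h s, ∃ p : (∀ i, A i) × (Fin n → Mood) → ℝ, h < H → p ∈ stdSimplex ℝ _ ∧
      (∀ z, PolyTendsto (fun ε => G.limitDist c ε h s z) (p z)) ∧
      ∀ z, p z ≠ 0 → ∀ b,
        ∑ i, G.stageGame h (W (h + 1)) s i b ≤ ∑ i, G.stageGame h (W (h + 1)) s i z.1 := by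
    intro h s
    by_cases hh : h < H
    · obtain ⟨p, hp⟩ := G.exists_limitDist_limit hc hU hh (hW (h + 1)) s
      exact ⟨p, fun _ => hp⟩
    · exact ⟨0, fun h => absurd h hh⟩
  choose p hp using hex
  have hW0 : ∀ h, H ≤ h → ∀ i s, W h i s = 0 := by
    intro h hh i s
    have h1 := (hW h i s).tendsto
    simp only [G.limitValue_of_le _ _ hh] at h1
    exact tendsto_nhds_unique h1 tendsto_const_nhds
  have hWeq : ∀ h, h < H → ∀ i s,
      W h i s = ∑ z, p h s z * G.stageGame h (W (h + 1)) s i z.1 := by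
    intro h hh i s
    refine tendsto_nhds_unique (hW h i s).tendsto ?_
    simp only [G.limitValue_of_lt _ _ hh]
    exact (PolyTendsto.sum _ fun z _ => ((hp h s hh).2.1 z).mul
      (G.polyTendsto_stageGame (hW (h + 1) i) h s z.1)).tendsto
  have hπ : G.IsPolicy fun h s a => ∑ ξ : Fin n → Mood, p h s (a, ξ) := by
    intro h hh s
    refine ⟨fun a => Finset.sum_nonneg fun ξ _ => (hp h s hh).1.1 _, ?_⟩
    rw [← Fintype.sum_prod_type]
    exact (hp h s hh).1.2
  have hval : ∀ h, ∀ i s,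
      G.valueFrom (fun h s a => ∑ ξ : Fin n → Mood, p h s (a, ξ)) h i s = W h i s := by
    refine backward_induction (H := H) (fun h hh i s => ?_) fun h hh ih i s => ?_
    · rw [G.valueFrom_of_le hh, hW0 h hh]
    · rw [G.valueFrom_eq hπ hh, hWeq h hh, Fintype.sum_prod_type]
      refine Finset.sum_congr rfl fun a _ => ?_
      rw [Finset.sum_mul, funext fun i => funext fun s => ih i s]
  have hopt : ∀ π', G.IsPolicy π' → ∀ h, ∀ s,
      ∑ i, G.valueFrom π' h i s ≤ ∑ i, W h i s := by
    intro π' hπ'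
    refine backward_induction (H := H) (fun h hh s => ?_) fun h hh ih s => ?_
    · simp only [G.valueFrom_of_le hh, hW0 h hh]
      exact le_rfl
    · obtain ⟨hp1, -, hp3⟩ := hp h s hh
      -- The right side averages the welfare over the support of `p h s`, where it is maximal.
      have h1 : ∀ a, ∑ i, G.stageGame h (W (h + 1)) s i a ≤ ∑ i, W h i s := by
        intro a
        simp only [hWeq h hh]
        rw [Finset.sum_comm]
        simp only [← Finset.mul_sum]
        rw [← one_mul (∑ i, G.stageGame h (W (h + 1)) s i a), ← hp1.2, Finset.sum_mul]
        refine Finset.sum_le_sum fun z _ => ?_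
        by_cases hz : p h s z = 0
        · simp [hz]
        · exact mul_le_mul_of_nonneg_left (hp3 z hz a) (hp1.1 z)
      simp only [G.valueFrom_eq hπ' hh]
      rw [Finset.sum_comm]
      simp only [← Finset.mul_sum]
      calc _ ≤ ∑ a, π' h s a * ∑ i, W h i s := Finset.sum_le_sum fun a _ =>
            mul_le_mul_of_nonneg_left ((G.sum_stageGame_mono hh ih s a).trans (h1 a))
              ((hπ' h hh s).1 a)
        _ = _ := by rw [← Finset.sum_mul, (hπ' h hh s).2, one_mul]
  refine ⟨p, fun h s z => ((hp h s h.2).2.1 z).tendsto, hπ, fun π' hπ' h hh s => ?_⟩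
  have h1 := hopt π' hπ' h s
  simp only [← hval, valueFrom, if_pos hh] at h1
  exact h1

end

end StochasticGame

/-! ### The main theorem -/

theorem corollary4 {n H : ℕ} {S : Type*} [Fintype S] [DecidableEq S] {A : Fin n → Type*}
    [∀ i, Fintype (A i)] [∀ i, DecidableEq (A i)] [∀ i, Nontrivial (A i)]
    (G : StochasticGame H S A) (c : ℝ) (hc : (n : ℝ) ≤ c)
    (hQ : ∀ π, G.IsPolicy π → ∀ i h, h < H → ∀ s a, G.Q π i h s a < 1)
    (hI : G.Interdependent) :
    ∃ (πε : ℝ → ℕ → S → (∀ i, A i) × (Fin n → Mood) → ℝ)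
      (πstar : ℕ → S → (∀ i, A i) × (Fin n → Mood) → ℝ),
      (∀ ε ∈ Set.Ioo (0 : ℝ) 1, ∀ ν ∈ stdSimplex ℝ G.Config, ∀ (h : Fin H) (s : S) z,
        Tendsto (fun t => G.iterDist c ε ν t h s z) atTop (𝓝 (πε ε h s z))) ∧
      (∀ (h : Fin H) (s : S) z,
        Tendsto (fun ε => πε ε h s z) (𝓝[>] 0) (𝓝 (πstar h s z))) ∧
      G.IsParetoOptimal (fun h s a => ∑ ξ : Fin n → Mood, πstar h s (a, ξ)) := by
  have hU : ∀ h, h < H → ∀ i s a, G.stageGame h (G.optimalValue (h + 1)) s i a < 1 :=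
    fun h hh i s a => G.stageGame_optimalValue_lt_one hQ hh i s a
  rcases isEmpty_or_nonempty (Fin n) with hn | hn
  -- Without agents there is a single joint action and a single mood profile, so all distributions
  -- are the constant `1`.
  · refine ⟨fun _ _ _ _ => 1, fun _ _ _ => 1, fun ε hε ν hν h s z => ?_,
      fun _ _ _ => tendsto_const_nhds, fun h _ s => ?_, fun π' _ h _ s => by simp⟩
    · refine tendsto_const_nhds.congr fun t => ?_
      have h1 : ∀ x : ℕ → G.Config, x t h s = z := fun x => Subsingleton.elim _ _
      simp only [G.iterDist_eq_pathExp, h1, if_true]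
      exact ((G.isProcess_configKernel hU hε ((Nat.cast_nonneg n).trans hc) hν).pathExp_const t
        1).symm
    · exact ⟨fun _ => Finset.sum_nonneg fun _ _ => zero_le_one, by simp⟩
  · have hc0 : 0 < c := lt_of_lt_of_le (by exact_mod_cast Fin.pos_iff_nonempty.2 hn) hc
    obtain ⟨πstar, h1, h2⟩ := G.exists_limitDist_limit_isParetoOptimal hc hU
    exact ⟨fun ε => G.limitDist c ε, πstar, fun ε hε ν hν h s z =>
      G.tendsto_iterDist_of_criticError hU hε hc0 hν h
        (G.tendsto_criticError hU hε hc0 hν (h + 1)) s z, h1, h2⟩
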